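/- Let $M$ be an $n$-dimensional $C^\infty$ manifold. A Finsler space $(M,L)$ is given by a function $L(x,y)>0$ that is $C^\infty$ and positively homogeneous of degree one in $y$ on an open conic set $\mathcal D$ of nonzero tangent vectors (classically all of $TM\setminus 0$), and whose metric tensor $g_{ij}=\frac12\dot\partial_i\dot\partial_jL^2$ is nondegenerate there, where $\partial_i=\partial/\partial x^i$, $\dot\partial_i=\partial/\partial y^i$. Put $$\gamma^i_{jk}=\tfrac12 g^{ir}(\partial_jg_{kr}+\partial_kg_{jr}-\partial_rg_{jk}),\quad G^i=\tfrac12\gamma^i_{jk}y^jy^k,\quad N^i_j=\dot\partial_jG^i,\quad \delta_i=\partial_i-N^r_i\dot\partial_r,$$ $$\Gamma^i_{jk}=\tfrac12 g^{ir}(\delta_jg_{kr}+\delta_kg_{jr}-\delta_rg_{jk}),\qquad C^i_{jk}=\tfrac12 g^{ir}\dot\partial_kg_{rj};$$ $(\Gamma^i_{jk},N^i_j,C^i_{jk})$ is the Cartan connection, and $|$ denotes its horizontal covariant derivative. Its (v)hv-torsion and hv-curvature are $$P^i_{jk}=\dot\partial_kN^i_j-\Gamma^i_{jk},\qquad P^i_{hjk}=\dot\partial_k\Gamma^i_{hj}-C^i_{hk|j}+C^i_{hm}P^m_{jk}.$$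 A Finsler space is a Landsberg space if $P^i_{hjk}=0$, or equivalently $P^i_{jk}=0$, on its domain. Let $\sigma$ be a $C^\infty$ function on $M$, let $\beta=b_i(x)\,dx^i$ be a $C^\infty$ one-form, and let $f$ be a function of two real variables that is $C^\infty$ and positively homogeneous of degree one on an open cone of the plane. Suppose that $(M,L)$ and $(M,\overline L)$ are Finsler spaces with domains $\overline{\mathcal D}\subseteq\mathcal D$, that $(e^{\sigma(x)}L(x,y),\beta(x,y))$ lies in that cone for $(x,y)\in\overline{\mathcal D}$, and that $\overline L$ arises from $L$ by the generalized $\beta$-conformal change $$\overline L(x,y)=f\bigl(e^{\sigma(x)}L(x,y),\,\beta(x,y)\bigr),\qquad \beta(x,y)=b_i(x)y^i,\qquad (x,y)\in\overline{\mathcal D}.$$ **Theorem.** Assume that $b_i$ is Cartan-parallel, $b_{i|j}=\partial_jb_i-b_r\Gamma^r_{ij}=0$ on $\mathcal D$, and that $\sigma$ is homothetic, $\partial_i\sigma=0$. If $(M,L)$ is a Landsberg space, then so is $(M,\overline L)$. More precisely, if $P^i_{jk}=0$ for $L$, then $\overline P^i_{jk}=0$ for $\overline L$; and if $P^i_{hjk}=0$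 for $L$, then $\overline P^i_{hjk}=0$ for $\overline L$. -/

import Mathlib

open scoped Manifold ContDiff

noncomputable section

namespace Finsler

/-! ### Local coordinate calculus

In a chart, an object on the tangent bundle is a function `A x y` of the position coordinates `x`
and the direction coordinates `y`. All indices are written in the order of the usual symbols,
the upper index first: `christoffel L i j k` is `Γ^i_{jk}`. -/

/-- The coordinate space `ℝⁿ`. -/
abbrev Coord (n : ℕ) : Type := EuclideanSpace ℝ (Fin n)

variable {n : ℕ}

/-- The `i`-th standard basis vector. -/
def basisVec (i : Fin n) : Coord n := EuclideanSpace.single i (1 : ℝ)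

/-- `∂_k A`: partial derivative with respect to `x^k`. -/
def dx (k : Fin n) (A : Coord n → Coord n → ℝ) : Coord n → Coord n → ℝ :=
  fun x y => fderiv ℝ (fun x' => A x' y) x (basisVec k)

/-- `∂̇_k A`: partial derivative with respect to `y^k`. -/
def dy (k : Fin n) (A : Coord n → Coord n → ℝ) : Coord n → Coord n → ℝ :=
  fun x y => fderiv ℝ (fun y' => A x y') y (basisVec k)

/-- The energy `E = L² / 2`. -/
def energy (L : Coord n → Coord n → ℝ) : Coord n → Coord n → ℝ :=
  fun x y => L x y ^ 2 / 2

/-- The Finsler metric tensor `g_{ij} = ∂̇_i ∂̇_j E`. -/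
def metric (L : Coord n → Coord n → ℝ) (i j : Fin n) : Coord n → Coord n → ℝ :=
  dy i (dy j (energy L))

/-- The matrix `(g_{ij})` at `(x, y)`. -/
def metricMatrix (L : Coord n → Coord n → ℝ) (x y : Coord n) : Matrix (Fin n) (Fin n) ℝ :=
  Matrix.of fun i j => metric L i j x y

/-- The inverse metric `g^{ij}`. -/
def metricInv (L : Coord n → Coord n → ℝ) (i j : Fin n) : Coord n → Coord n → ℝ :=
  fun x y => (metricMatrix L x y)⁻¹ i j

/-- The Cartan tensor `C_{ijk} = (1/2) ∂̇_k g_{ij}`. -/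
def cartan (L : Coord n → Coord n → ℝ) (i j k : Fin n) : Coord n → Coord n → ℝ :=
  fun x y => dy k (metric L i j) x y / 2

/-- The (h)hv-torsion `C^i_{jk} = g^{ri} C_{rjk}`. -/
def cartanUp (L : Coord n → Coord n → ℝ) (i j k : Fin n) : Coord n → Coord n → ℝ :=
  fun x y => ∑ r, metricInv L r i x y * cartan L r j k x y

/-- The Christoffel symbols with respect to `∂_i`,
`γ^i_{jk} = (1/2) g^{ir} (∂_j g_{kr} + ∂_k g_{jr} - ∂_r g_{jk})`. -/
def formalChristoffel (L : Coord n → Coord n → ℝ) (i j k : Fin n) : Coord n → Coord n → ℝ :=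
  fun x y => (1 / 2) * ∑ r, metricInv L i r x y *
    (dx j (metric L k r) x y + dx k (metric L j r) x y - dx r (metric L j k) x y)

/-- The canonical spray `G^i = (1/2) γ^i_{jk} y^j y^k`. -/
def spray (L : Coord n → Coord n → ℝ) (i : Fin n) : Coord n → Coord n → ℝ :=
  fun x y => (1 / 2) * ∑ j, ∑ k, formalChristoffel L i j k x y * y j * y k

/-- The Barthel (Cartan) nonlinear connection `N^i_j = ∂̇_j G^i`. -/
def nonlinear (L : Coord n → Coord n → ℝ) (i j : Fin n) : Coord n → Coord n → ℝ :=
  dy j (spray L i)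

/-- The horizontal derivation `δ_k = ∂_k - N^r_k ∂̇_r`. -/
def delta (L : Coord n → Coord n → ℝ) (k : Fin n) (A : Coord n → Coord n → ℝ) :
    Coord n → Coord n → ℝ :=
  fun x y => dx k A x y - ∑ r, nonlinear L r k x y * dy r A x y

/-- The horizontal coefficients of the Cartan connection,
`Γ^i_{jk} = (1/2) g^{ir} (δ_j g_{kr} + δ_k g_{jr} - δ_r g_{jk})`. -/
def christoffel (L : Coord n → Coord n → ℝ) (i j k : Fin n) : Coord n → Coord n → ℝ :=
  fun x y => (1 / 2) * ∑ r, metricInv L i r x y *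
    (delta L j (metric L k r) x y + delta L k (metric L j r) x y - delta L r (metric L j k) x y)

/-- The horizontal covariant derivative `a_{i|j} = δ_j a_i - a_r Γ^r_{ij}` of a covariant vector,
for the Cartan connection. -/
def hcovCovector (L : Coord n → Coord n → ℝ) (a : Fin n → Coord n → Coord n → ℝ) (i j : Fin n) :
    Coord n → Coord n → ℝ :=
  fun x y => delta L j (a i) x y - ∑ r, a r x y * christoffel L r i j x y

/-- The horizontal covariant derivative of `C^i_{hk}`,
`C^i_{hk|j} = δ_j C^i_{hk} + C^r_{hk} Γ^i_{rj} - C^i_{rk} Γ^r_{hj} - C^i_{hr} Γ^r_{kj}`. -/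
def hcovCartanUp (L : Coord n → Coord n → ℝ) (i h k j : Fin n) : Coord n → Coord n → ℝ :=
  fun x y => delta L j (cartanUp L i h k) x y
    + ∑ r, cartanUp L r h k x y * christoffel L i r j x y
    - ∑ r, cartanUp L i r k x y * christoffel L r h j x y
    - ∑ r, cartanUp L i h r x y * christoffel L r k j x y

/-- The (v)hv-torsion of the Cartan connection, `P^i_{jk} = ∂̇_k N^i_j - Γ^i_{jk}`. -/
def hvTorsion (L : Coord n → Coord n → ℝ) (i j k : Fin n) : Coord n → Coord n → ℝ :=
  fun x y => dy k (nonlinear L i j) x y - christoffel L i j k x y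

/-- The hv-curvature of the Cartan connection,
`P^i_{hjk} = ∂̇_k Γ^i_{hj} - C^i_{hk|j} + C^i_{hm} P^m_{jk}`. -/
def hvCurvature (L : Coord n → Coord n → ℝ) (i h j k : Fin n) : Coord n → Coord n → ℝ :=
  fun x y => dy k (christoffel L i h j) x y - hcovCartanUp L i h k j x y
    + ∑ m, cartanUp L i h m x y * hvTorsion L m j k x y

/-! ### Finsler spaces on manifolds -/

section Manifold

variable {M : Type*} [TopologicalSpace M] [ChartedSpace (Coord n) M] [IsManifold (𝓡 n) ∞ M]

/-- The tangent vector with coordinates `(x, y)` in the chart `φ`; it is meaningful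
for `x ∈ φ.target`. -/
def chartVec (φ : OpenPartialHomeomorph M (Coord n)) (x y : Coord n) : TangentBundle (𝓡 n) M :=
  ⟨φ.symm x, mfderiv (𝓡 n) (𝓡 n) φ.symm x y⟩

/-- The expression in the chart `φ` of a function on the tangent bundle. -/
def inChart (A : TangentBundle (𝓡 n) M → ℝ) (φ : OpenPartialHomeomorph M (Coord n)) :
    Coord n → Coord n → ℝ :=
  fun x y => A (chartVec φ x y)

variable (n M)

/-- A `C^∞` Finsler space `(M, L)`. The domain `dom` of the fundamental function is an open conic
set of nonzero tangent vectors; it is the set of all nonzero tangent vectors in the classical case,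
and a smaller one, for example, for Kropina metrics. The metric tensor is required
to be nondegenerate, so positive definite Finsler metrics are included. -/
structure FinslerSpace where
  L : TangentBundle (𝓡 n) M → ℝ
  dom : Set (TangentBundle (𝓡 n) M)
  isOpen_dom : IsOpen dom
  ne_zero : ∀ v ∈ dom, v.2 ≠ 0
  smul_mem : ∀ v ∈ dom, ∀ t : ℝ, 0 < t → (⟨v.1, t • v.2⟩ : TangentBundle (𝓡 n) M) ∈ dom
  smooth : ContMDiffOn (𝓡 n).tangent 𝓘(ℝ, ℝ) ∞ L dom
  pos : ∀ v ∈ dom, 0 < L v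
  homogeneous : ∀ v ∈ dom, ∀ t : ℝ, 0 < t → L ⟨v.1, t • v.2⟩ = t * L v
  nondegenerate : ∀ φ ∈ IsManifold.maximalAtlas (𝓡 n) ∞ M, ∀ x ∈ φ.target, ∀ y,
    chartVec φ x y ∈ dom → (metricMatrix (inChart L φ) x y).det ≠ 0

/-- A `C^∞` differential one-form on `M`, whose smoothness is that of the fibrewise linear function
`β(x, y) = b_i(x) y^i` on the tangent bundle. -/
structure OneForm where
  form : ∀ p : M, TangentSpace (𝓡 n) p →ₗ[ℝ] ℝ
  smooth : ContMDiff (𝓡 n).tangent 𝓘(ℝ, ℝ) ∞ fun v : TangentBundle (𝓡 n) M => form v.1 v.2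

variable {n M}

/-- The function `β(x, y) = b_i(x) y^i` on the tangent bundle. -/
def OneForm.beta (b : OneForm n M) (v : TangentBundle (𝓡 n) M) : ℝ := b.form v.1 v.2

/-- The components `b_i(x)` in a chart, as functions of `(x, y)` that do not depend on `y`. -/
def OneForm.component (b : OneForm n M) (φ : OpenPartialHomeomorph M (Coord n)) (i : Fin n) :
    Coord n → Coord n → ℝ :=
  fun x _ => inChart b.beta φ x (basisVec i)

/-- `b_i` is Cartan-parallel: `b_{i|j} = 0` for the Cartan connection of `F`. -/
def FinslerSpace.CartanParallel (F : FinslerSpace n M) (b : OneForm n M) : Prop :=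
  ∀ φ ∈ IsManifold.maximalAtlas (𝓡 n) ∞ M, ∀ x ∈ φ.target, ∀ y, chartVec φ x y ∈ F.dom →
    ∀ i j, hcovCovector (inChart F.L φ) (b.component φ) i j x y = 0

/-- `P^i_{jk} = 0` for the Cartan connection. -/
def FinslerSpace.HvTorsionVanishes (F : FinslerSpace n M) : Prop :=
  ∀ φ ∈ IsManifold.maximalAtlas (𝓡 n) ∞ M, ∀ x ∈ φ.target, ∀ y, chartVec φ x y ∈ F.dom →
    ∀ i j k, hvTorsion (inChart F.L φ) i j k x y = 0

/-- `P^i_{hjk} = 0` for the Cartan connection. -/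
def FinslerSpace.HvCurvatureVanishes (F : FinslerSpace n M) : Prop :=
  ∀ φ ∈ IsManifold.maximalAtlas (𝓡 n) ∞ M, ∀ x ∈ φ.target, ∀ y, chartVec φ x y ∈ F.dom →
    ∀ i h j k, hvCurvature (inChart F.L φ) i h j k x y = 0

variable (n) in
/-- `σ` is homothetic: `∂_i σ = 0`. -/
def Homothetic (σ : M → ℝ) : Prop := ∀ p, mfderiv (𝓡 n) 𝓘(ℝ, ℝ) σ p = 0

/-- `F'` arises from `F` by the generalized `β`-conformal change `L' = f (e^σ L, β)`, where `f` is
smooth and positively homogeneous of degree one on an open cone `D` of the plane that contains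
all the values `(e^σ L, β)`. -/
structure IsGeneralizedBetaConformalChange (F F' : FinslerSpace n M) (f : ℝ → ℝ → ℝ)
    (D : Set (ℝ × ℝ)) (σ : M → ℝ) (b : OneForm n M) : Prop where
  isOpen : IsOpen D
  smul_mem : ∀ p ∈ D, ∀ t : ℝ, 0 < t → (t * p.1, t * p.2) ∈ D
  smooth_f : ContDiffOn ℝ ∞ (fun p : ℝ × ℝ => f p.1 p.2) D
  homogeneous : ∀ p ∈ D, ∀ t : ℝ, 0 < t → f (t * p.1) (t * p.2) = t * f p.1 p.2
  smooth_sigma : ContMDiff (𝓡 n) 𝓘(ℝ, ℝ) ∞ σ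
  dom_subset : F'.dom ⊆ F.dom
  mem : ∀ v ∈ F'.dom, (Real.exp (σ v.1) * F.L v, b.beta v) ∈ D
  eq : ∀ v ∈ F'.dom, F'.L v = f (Real.exp (σ v.1) * F.L v) (b.beta v)

end Manifold

end Finsler

end

/-! Every Finsler function is horizontally constant for its own nonlinear connection: δ_k L = 0
(`LocalFinsler.delta_energy`). Contracting b_{i|j} = 0 with y^i gives δ_k β = 0, and a homothetic σ
has zero differential, so L' = f(e^σ L, β) satisfies δ_k L' = 0 for the connection of L. The spray
of L' is determined by the first derivatives of its energy E' and their vertical derivatives, and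
δ_k E' = 0 forces it to be the spray of L (`LocalFinsler.spray_eq`). Hence N, δ and the Berwald
curvature G^r_{ijk} = ∂̇_j ∂̇_i N^r_k are common to both spaces.

Two vertical derivatives of δ_k E' = 0 show that the Berwald coefficients ∂̇_k N^r_j preserve g' up
to the term G^r_{ijk} ∂̇_r E'. If that term vanishes, they are symmetric and metric, so they are the
Cartan coefficients of L', and P' = 0 (`LocalFinsler.hvTorsion_eq_zero`). The term vanishes because
the vertical vector G^r_{ijk} kills both L and β. For L this is the same computation read backwards,
with Γ = ∂̇N by the Landsberg condition. For β, parallelism reads ∂_i b_k = b_r ∂̇_i N^r_k, whose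
left side does not depend on y, so b_r G^r_{ijk} = 0.

The hv-curvature statement follows from the equivalence of the two Landsberg conditions. Contracting
P^i_{hjk} with y^h yields P^i_{jk}. Conversely, if P^i_{jk} = 0, then ∂̇Γ is the Berwald curvature,
and the total symmetry of the Cartan tensor makes the lowered Berwald curvature totally symmetric
and equal to C_{ijl|k} (`LocalFinsler.hvCurvature_eq_zero`). -/

namespace Finsler

/-! ### Calculus of ∂_k, ∂̇_k and δ_k as directional derivatives. -/

section Calculus

variable {n : ℕ} {U : Set (Coord n × Coord n)} {A B : Coord n → Coord n → ℝ} {x y : Coord n}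

/-- `A` is smooth as a function of both variables on `U`. -/
def SmoothOn (U : Set (Coord n × Coord n)) (A : Coord n → Coord n → ℝ) : Prop :=
  ContDiffOn ℝ ∞ (fun p : Coord n × Coord n => A p.1 p.2) U

lemma SmoothOn.mono {V : Set (Coord n × Coord n)} (hA : SmoothOn U A) (hV : V ⊆ U) :
    SmoothOn V A := ContDiffOn.mono hA hV

lemma SmoothOn.differentiableAt (hU : IsOpen U) (hp : (x, y) ∈ U) (hA : SmoothOn U A) :
    DifferentiableAt ℝ (fun p : Coord n × Coord n => A p.1 p.2) (x, y) :=
  (ContDiffOn.contDiffAt hA (hU.mem_nhds hp)).differentiableAt (by simp)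

lemma SmoothOn.add (hA : SmoothOn U A) (hB : SmoothOn U B) :
    SmoothOn U (fun x y => A x y + B x y) := ContDiffOn.add hA hB

lemma SmoothOn.sub (hA : SmoothOn U A) (hB : SmoothOn U B) :
    SmoothOn U (fun x y => A x y - B x y) := ContDiffOn.sub hA hB

lemma SmoothOn.mul (hA : SmoothOn U A) (hB : SmoothOn U B) :
    SmoothOn U (fun x y => A x y * B x y) := ContDiffOn.mul hA hB

lemma SmoothOn.const_mul (c : ℝ) (hA : SmoothOn U A) :
    SmoothOn U (fun x y => c * A x y) := ContDiffOn.mul contDiffOn_const hA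

lemma SmoothOn.sum {ι : Type*} {s : Finset ι} {A : ι → Coord n → Coord n → ℝ}
    (hA : ∀ i, SmoothOn U (A i)) : SmoothOn U (fun x y => ∑ i ∈ s, A i x y) :=
  ContDiffOn.sum fun i _ => hA i

lemma smoothOn_coord (i : Fin n) : SmoothOn U (fun _ y => y i) := by
  have : ContDiff ℝ ∞ (fun p : Coord n × Coord n => p.2 i) := by fun_prop
  exact this.contDiffOn

lemma SmoothOn.congr (hA : SmoothOn U A) (h : ∀ x y, (x, y) ∈ U → B x y = A x y) :
    SmoothOn U B := ContDiffOn.congr hA fun p hp => h p.1 p.2 hp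

/-- The derivative of `A` at `(x, y)` in the direction `v`. -/
noncomputable def dir (v : Coord n × Coord n) (A : Coord n → Coord n → ℝ) (x y : Coord n) : ℝ :=
  fderiv ℝ (fun p : Coord n × Coord n => A p.1 p.2) (x, y) v

lemma dx_eq_dir (hU : IsOpen U) (hp : (x, y) ∈ U) (hA : SmoothOn U A) (k : Fin n) :
    dx k A x y = dir (basisVec k, 0) A x y := by
  have h1 := (hA.differentiableAt hU hp).hasFDerivAt
  have h2 : HasFDerivAt (fun x' : Coord n => (x', y))
      ((ContinuousLinearMap.id ℝ (Coord n)).prod 0) x :=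
    (hasFDerivAt_id x).prodMk (hasFDerivAt_const y x)
  have h3 := HasFDerivAt.comp x h1 h2
  have h4 : fderiv ℝ (fun x' => A x' y) x = _ := h3.fderiv
  simp [dx, dir, h4]

lemma dy_eq_dir (hU : IsOpen U) (hp : (x, y) ∈ U) (hA : SmoothOn U A) (k : Fin n) :
    dy k A x y = dir (0, basisVec k) A x y := by
  have h1 := (hA.differentiableAt hU hp).hasFDerivAt
  have h2 : HasFDerivAt (fun y' : Coord n => (x, y'))
      ((0 : Coord n →L[ℝ] Coord n).prod (ContinuousLinearMap.id ℝ (Coord n))) y :=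
    (hasFDerivAt_const x y).prodMk (hasFDerivAt_id y)
  have h3 := HasFDerivAt.comp y h1 h2
  have h4 : fderiv ℝ (fun y' => A x y') y = _ := h3.fderiv
  simp [dy, dir, h4]

lemma dir_sum_right (v : Coord n) (w : Fin n → ℝ) :
    dir (v, ∑ r, w r • basisVec r) A x y
      = dir (v, 0) A x y + ∑ r, w r * dir (0, basisVec r) A x y := by
  have : ((v, ∑ r, w r • basisVec r) : Coord n × Coord n)
      = (v, 0) + ∑ r, w r • ((0 : Coord n), basisVec r) := by
    ext1 <;> simp [Prod.fst_sum, Prod.snd_sum]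
  rw [this]
  simp only [dir, map_add, map_sum, map_smul, smul_eq_mul]

/-- At a fixed point δ_k is differentiation along a single tangent vector, the horizontal lift of
∂_k. Only the values of N at that point enter, so nothing about the regularity of N is needed. -/
lemma delta_eq_dir (L : Coord n → Coord n → ℝ) (hU : IsOpen U) (hp : (x, y) ∈ U)
    (hA : SmoothOn U A) (k : Fin n) :
    delta L k A x y = dir (basisVec k, ∑ r, (-nonlinear L r k x y) • basisVec r) A x y := by
  rw [dir_sum_right]
  simp only [delta, dx_eq_dir hU hp hA, dy_eq_dir hU hp hA, neg_mul, Finset.sum_neg_distrib,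
    sub_eq_add_neg]

lemma dir_congr (hU : IsOpen U) (hp : (x, y) ∈ U) (v : Coord n × Coord n)
    (h : ∀ x y, (x, y) ∈ U → A x y = B x y) : dir v A x y = dir v B x y := by
  have : (fun p : Coord n × Coord n => A p.1 p.2) =ᶠ[nhds (x, y)] fun p => B p.1 p.2 := by
    filter_upwards [hU.mem_nhds hp] with p hp using h p.1 p.2 hp
  simp [dir, this.fderiv_eq]

/-- `D` is the evaluation at `(x, y)` of a directional derivative. -/
def IsDirAt (U : Set (Coord n × Coord n)) (x y : Coord n)
    (D : (Coord n → Coord n → ℝ) → ℝ) : Prop :=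
  IsOpen U ∧ (x, y) ∈ U ∧ ∃ v, ∀ A, SmoothOn U A → D A = dir v A x y

variable {D : (Coord n → Coord n → ℝ) → ℝ}

/-- Since `U` is open, an identity valid on `U` may be differentiated. This is how each tensor
identity below is passed through ∂_k, ∂̇_k or δ_k. -/
lemma IsDirAt.congr (hD : IsDirAt U x y D) (hB : SmoothOn U B)
    (h : ∀ x y, (x, y) ∈ U → A x y = B x y) : D A = D B := by
  obtain ⟨hU, hp, v, hv⟩ := hD
  rw [hv A (hB.congr h), hv B hB, dir_congr hU hp v h]

lemma IsDirAt.mul (hD : IsDirAt U x y D) (hA : SmoothOn U A) (hB : SmoothOn U B) :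
    D (fun x y => A x y * B x y) = D A * B x y + A x y * D B := by
  obtain ⟨hU, hp, v, hv⟩ := hD
  rw [hv _ (hA.mul hB), hv _ hA, hv _ hB]
  simp only [dir]
  rw [fderiv_fun_mul (hA.differentiableAt hU hp) (hB.differentiableAt hU hp)]
  simp only [add_apply, smul_apply, smul_eq_mul]
  ring

lemma IsDirAt.const_mul (hD : IsDirAt U x y D) (c : ℝ) (hA : SmoothOn U A) :
    D (fun x y => c * A x y) = c * D A := by
  obtain ⟨hU, hp, v, hv⟩ := hD
  rw [hv _ (hA.const_mul c), hv _ hA]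
  simp only [dir]
  rw [fderiv_const_mul (hA.differentiableAt hU hp)]
  simp

lemma IsDirAt.const (hD : IsDirAt U x y D) (c : ℝ) : D (fun _ _ => c) = 0 := by
  obtain ⟨hU, hp, v, hv⟩ := hD
  rw [hv (fun _ _ => c) contDiffOn_const]
  simp [dir]

lemma IsDirAt.add (hD : IsDirAt U x y D) (hA : SmoothOn U A) (hB : SmoothOn U B) :
    D (fun x y => A x y + B x y) = D A + D B := by
  obtain ⟨hU, hp, v, hv⟩ := hD
  rw [hv _ (hA.add hB), hv _ hA, hv _ hB]
  simp only [dir]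
  rw [fderiv_fun_add (hA.differentiableAt hU hp) (hB.differentiableAt hU hp)]
  simp

lemma IsDirAt.sub (hD : IsDirAt U x y D) (hA : SmoothOn U A) (hB : SmoothOn U B) :
    D (fun x y => A x y - B x y) = D A - D B := by
  obtain ⟨hU, hp, v, hv⟩ := hD
  rw [hv _ (hA.sub hB), hv _ hA, hv _ hB]
  simp only [dir]
  rw [fderiv_fun_sub (hA.differentiableAt hU hp) (hB.differentiableAt hU hp)]
  simp

lemma IsDirAt.sum (hD : IsDirAt U x y D) {ι : Type*} {s : Finset ι}
    {A : ι → Coord n → Coord n → ℝ} (hA : ∀ i, SmoothOn U (A i)) :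
    D (fun x y => ∑ i ∈ s, A i x y) = ∑ i ∈ s, D (A i) := by
  obtain ⟨hU, hp, v, hv⟩ := hD
  rw [hv _ (SmoothOn.sum hA), Finset.sum_congr rfl fun i _ => hv _ (hA i)]
  simp only [dir]
  rw [fderiv_fun_sum fun i _ => (hA i).differentiableAt hU hp]
  simp

lemma IsDirAt.sum_mul (hD : IsDirAt U x y D) {ι : Type*} {s : Finset ι}
    {A B : ι → Coord n → Coord n → ℝ} (hA : ∀ i, SmoothOn U (A i)) (hB : ∀ i, SmoothOn U (B i)) :
    D (fun x y => ∑ i ∈ s, A i x y * B i x y)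
      = ∑ i ∈ s, D (A i) * B i x y + ∑ i ∈ s, A i x y * D (B i) := by
  rw [hD.sum fun i => (hA i).mul (hB i), ← Finset.sum_add_distrib]
  exact Finset.sum_congr rfl fun i _ => hD.mul (hA i) (hB i)

lemma isDirAt_dx (hU : IsOpen U) (hp : (x, y) ∈ U) (k : Fin n) :
    IsDirAt U x y (fun A => dx k A x y) :=
  ⟨hU, hp, _, fun _ hA => dx_eq_dir hU hp hA k⟩

lemma isDirAt_dy (hU : IsOpen U) (hp : (x, y) ∈ U) (k : Fin n) :
    IsDirAt U x y (fun A => dy k A x y) :=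
  ⟨hU, hp, _, fun _ hA => dy_eq_dir hU hp hA k⟩

lemma isDirAt_delta (L : Coord n → Coord n → ℝ) (hU : IsOpen U) (hp : (x, y) ∈ U) (k : Fin n) :
    IsDirAt U x y (fun A => delta L k A x y) :=
  ⟨hU, hp, _, fun _ hA => delta_eq_dir L hU hp hA k⟩

lemma smoothOn_dir (hU : IsOpen U) (hA : SmoothOn U A) (v : Coord n × Coord n) :
    SmoothOn U (dir v A) := by
  have : ContDiffOn ℝ ∞ (fderiv ℝ fun p : Coord n × Coord n => A p.1 p.2) U :=
    ContDiffOn.fderiv_of_isOpen hA hU (by simp)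
  exact this.clm_apply contDiffOn_const

lemma SmoothOn.dx (hU : IsOpen U) (hA : SmoothOn U A) (k : Fin n) : SmoothOn U (dx k A) :=
  (smoothOn_dir hU hA _).congr fun _ _ hp => dx_eq_dir hU hp hA k

lemma SmoothOn.dy (hU : IsOpen U) (hA : SmoothOn U A) (k : Fin n) : SmoothOn U (dy k A) :=
  (smoothOn_dir hU hA _).congr fun _ _ hp => dy_eq_dir hU hp hA k

lemma dir_comm (hU : IsOpen U) (hp : (x, y) ∈ U) (hA : SmoothOn U A) (v w : Coord n × Coord n) :
    dir v (dir w A) x y = dir w (dir v A) x y := by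
  have hc : ContDiffAt ℝ ∞ (fun p : Coord n × Coord n => A p.1 p.2) (x, y) :=
    ContDiffOn.contDiffAt hA (hU.mem_nhds hp)
  have hs : IsSymmSndFDerivAt ℝ (fun p : Coord n × Coord n => A p.1 p.2) (x, y) :=
    hc.isSymmSndFDerivAt (by simp; norm_cast)
  have hd : DifferentiableAt ℝ (fderiv ℝ (fun p : Coord n × Coord n => A p.1 p.2)) (x, y) :=
    (hc.fderiv_right (m := 1) (by norm_cast)).differentiableAt (by simp)
  -- The first derivative is evaluated on a constant vector, so one more differentiation gives the
  -- flipped second derivative, and symmetry of the latter finishes.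
  have key : ∀ u : Coord n × Coord n, fderiv ℝ (fun p : Coord n × Coord n => dir u A p.1 p.2) (x, y)
      = (fderiv ℝ (fderiv ℝ (fun p : Coord n × Coord n => A p.1 p.2)) (x, y)).flip u := by
    intro u
    simp only [dir]
    rw [fderiv_clm_apply hd (differentiableAt_const u)]
    simp
  simp only [dir] at key ⊢
  rw [key w, key v]
  exact hs v w

lemma dy_dy_comm (hU : IsOpen U) (hp : (x, y) ∈ U) (hA : SmoothOn U A) (i j : Fin n) :
    dy i (dy j A) x y = dy j (dy i A) x y := by
  rw [(isDirAt_dy hU hp i).congr (smoothOn_dir hU hA _) fun _ _ h => dy_eq_dir hU h hA j,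
    (isDirAt_dy hU hp j).congr (smoothOn_dir hU hA _) fun _ _ h => dy_eq_dir hU h hA i,
    dy_eq_dir hU hp (smoothOn_dir hU hA _), dy_eq_dir hU hp (smoothOn_dir hU hA _),
    dir_comm hU hp hA]

lemma dy_dx_comm (hU : IsOpen U) (hp : (x, y) ∈ U) (hA : SmoothOn U A) (i j : Fin n) :
    dy i (dx j A) x y = dx j (dy i A) x y := by
  rw [(isDirAt_dy hU hp i).congr (smoothOn_dir hU hA _) fun _ _ h => dx_eq_dir hU h hA j,
    (isDirAt_dx hU hp j).congr (smoothOn_dir hU hA _) fun _ _ h => dy_eq_dir hU h hA i,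
    dy_eq_dir hU hp (smoothOn_dir hU hA _), dx_eq_dir hU hp (smoothOn_dir hU hA _),
    dir_comm hU hp hA]

lemma dy_coord (i k : Fin n) (x y : Coord n) :
    dy k (fun _ y => y i) x y = if i = k then 1 else 0 := by
  have : fderiv ℝ (fun y' : Coord n => y' i) y = EuclideanSpace.proj i :=
    ContinuousLinearMap.fderiv (EuclideanSpace.proj i : EuclideanSpace ℝ (Fin n) →L[ℝ] ℝ)
  simp [dy, this, basisVec]

lemma dx_eq_zero (A : Coord n → ℝ) (k : Fin n) (x y : Coord n) :
    dx k (fun _ y => A y) x y = 0 := by simp [dx]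

lemma dy_eq_zero (A : Coord n → ℝ) (k : Fin n) (x y : Coord n) :
    dy k (fun x _ => A x) x y = 0 := by simp [dy]

lemma delta_coord (L : Coord n → Coord n → ℝ) (i k : Fin n) (x y : Coord n) :
    delta L k (fun _ y => y i) x y = -nonlinear L i k x y := by
  simp only [delta, dx_eq_zero, dy_coord]
  simp

/-! ### Homogeneity in y and Euler's relation. -/

/-- `A` is positively homogeneous of degree `r` in `y` on `U`. -/
def HomogeneousOn (U : Set (Coord n × Coord n)) (r : ℕ) (A : Coord n → Coord n → ℝ) : Prop :=
  ∀ x y, (x, y) ∈ U → ∀ t : ℝ, 0 < t → A x (t • y) = t ^ r * A x y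

/-- `U` is conic in `y`. -/
def Conic (U : Set (Coord n × Coord n)) : Prop :=
  ∀ x y, (x, y) ∈ U → ∀ t : ℝ, 0 < t → (x, t • y) ∈ U

lemma HomogeneousOn.dx (hU : IsOpen U) {r : ℕ} (hA : SmoothOn U A)
    (h : HomogeneousOn U r A) (k : Fin n) : HomogeneousOn U r (dx k A) := by
  intro x y hp t ht
  have h1 : (fun x' => A x' (t • y)) =ᶠ[nhds x] fun x' => t ^ r * A x' y := by
    have : (fun x' : Coord n => (x', y)) ⁻¹' U ∈ nhds x :=
      ((Continuous.prodMk_left y).continuousAt).preimage_mem_nhds (hU.mem_nhds hp)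
    filter_upwards [this] with x' hx' using h x' y hx' t ht
  have h2 : DifferentiableAt ℝ (fun x' => A x' y) x :=
    DifferentiableAt.comp (f := fun x' : Coord n => (x', y)) x (hA.differentiableAt hU hp)
      (differentiableAt_id.prodMk (differentiableAt_const y))
  simp only [Finsler.dx]
  rw [h1.fderiv_eq, fderiv_const_mul h2]
  simp

lemma HomogeneousOn.dy (hU : IsOpen U) (hc : Conic U) {r : ℕ} (hA : SmoothOn U A)
    (h : HomogeneousOn U (r + 1) A) (k : Fin n) : HomogeneousOn U r (dy k A) := by
  intro x y hp t ht
  have hd : ∀ z, (x, z) ∈ U → DifferentiableAt ℝ (fun y' => A x y') z := fun z hz =>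
    DifferentiableAt.comp (f := fun y' : Coord n => (x, y')) z (hA.differentiableAt hU hz)
      ((differentiableAt_const x).prodMk differentiableAt_id)
  have h1 : (fun y' => A x (t • y')) =ᶠ[nhds y] fun y' => t ^ (r + 1) * A x y' := by
    have : (fun y' : Coord n => (x, y')) ⁻¹' U ∈ nhds y :=
      ((Continuous.prodMk_right x).continuousAt).preimage_mem_nhds (hU.mem_nhds hp)
    filter_upwards [this] with y' hy' using h x y' hy' t ht
  have h2 := congrArg (fun T : Coord n →L[ℝ] ℝ => T (basisVec k)) h1.fderiv_eq
  have h3 : HasFDerivAt (fun y' => A x (t • y')) _ y :=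
    (hd _ (hc x y hp t ht)).hasFDerivAt.comp y ((hasFDerivAt_id y).const_smul t)
  simp only [fderiv_const_mul (hd y hp), h3.fderiv] at h2
  simp only [Finsler.dy]
  simp at h2
  have := ht.ne'
  -- The chain rule for y ↦ t • y produces one factor t, and cancelling it lowers the degree by one.
  apply mul_left_cancel₀ this
  rw [h2]; ring

lemma coord_eq_sum (y : Coord n) : y = ∑ k, y k • basisVec k := by
  ext i
  simp [basisVec, Pi.single_apply]

/-- Both sides are the derivative of t ↦ A(x, t y) at t = 1, once by the chain rule and once from
t^r A(x, y). -/
lemma HomogeneousOn.euler (hU : IsOpen U) {r : ℕ} (hA : SmoothOn U A)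
    (h : HomogeneousOn U r A) (hp : (x, y) ∈ U) : ∑ k, y k * Finsler.dy k A x y = r * A x y := by
  have hd : DifferentiableAt ℝ (fun y' => A x y') y :=
    DifferentiableAt.comp (f := fun y' : Coord n => (x, y')) y (hA.differentiableAt hU hp)
      ((differentiableAt_const x).prodMk differentiableAt_id)
  have h1 : HasDerivAt (fun t : ℝ => t • y) ((1 : ℝ) • y) 1 :=
    (hasDerivAt_id (1 : ℝ)).smul_const y
  have h2 : HasDerivAt (fun t : ℝ => A x (t • y)) (fderiv ℝ (fun y' => A x y') y y) 1 := by
    have h4 : HasFDerivAt (fun y' => A x y') (fderiv ℝ (fun y' => A x y') y) ((1 : ℝ) • y) := by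
      simpa using hd.hasFDerivAt
    have h5 := h4.comp_hasDerivAt (1 : ℝ) h1
    rw [one_smul] at h5
    exact h5
  have h3 : HasDerivAt (fun t : ℝ => A x (t • y)) (r * A x y) 1 := by
    have h4 : HasDerivAt (fun t : ℝ => t ^ r * A x y) (r * 1 ^ (r - 1) * A x y) 1 :=
      (hasDerivAt_pow r (1 : ℝ)).mul_const _
    have h5 : (fun t : ℝ => A x (t • y)) =ᶠ[nhds 1] fun t => t ^ r * A x y := by
      filter_upwards [lt_mem_nhds (zero_lt_one' ℝ)] with t ht using h x y hp t ht
    simpa using h4.congr_of_eventuallyEq h5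
  rw [← h2.unique h3]
  have h6 := congrArg (fderiv ℝ (fun y' => A x y') y) (coord_eq_sum y)
  rw [h6]
  simp only [map_sum, map_smul, smul_eq_mul, Finsler.dy]

end Calculus

/-! ### Finsler functions in coordinates: metric, spray and nonlinear connection. -/

section LocalFinsler

variable {n : ℕ} {U : Set (Coord n × Coord n)} {L A : Coord n → Coord n → ℝ} {x y : Coord n}

/-- `L` is a Finsler fundamental function in coordinates, on the open conic set `U`. -/
structure LocalFinsler (L : Coord n → Coord n → ℝ) (U : Set (Coord n × Coord n)) : Prop where
  isOpen : IsOpen U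
  conic : Conic U
  smooth : SmoothOn U L
  pos : ∀ x y, (x, y) ∈ U → 0 < L x y
  homogeneous : HomogeneousOn U 1 L
  nondegenerate : ∀ x y, (x, y) ∈ U → (metricMatrix L x y).det ≠ 0

lemma LocalFinsler.mono {V : Set (Coord n × Coord n)} (h : LocalFinsler L U) (hV : IsOpen V)
    (hc : Conic V) (hVU : V ⊆ U) : LocalFinsler L V where
  isOpen := hV
  conic := hc
  smooth := h.smooth.mono hVU
  pos x y hp := h.pos x y (hVU hp)
  homogeneous x y hp := h.homogeneous x y (hVU hp)
  nondegenerate x y hp := h.nondegenerate x y (hVU hp)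

namespace LocalFinsler

lemma smooth_energy (h : LocalFinsler L U) : SmoothOn U (energy L) :=
  ((h.smooth.mul h.smooth).const_mul (1 / 2)).congr fun x y _ => by simp only [energy]; ring

lemma smooth_dy_energy (h : LocalFinsler L U) (i : Fin n) : SmoothOn U (dy i (energy L)) :=
  h.smooth_energy.dy h.isOpen i

lemma smooth_metric (h : LocalFinsler L U) (i j : Fin n) : SmoothOn U (metric L i j) :=
  (h.smooth_dy_energy j).dy h.isOpen i

lemma smooth_det {m : Type*} [Fintype m] [DecidableEq m]
    {T : m → m → Coord n → Coord n → ℝ} (hT : ∀ i j, SmoothOn U (T i j)) :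
    SmoothOn U fun x y => (Matrix.of fun i j => T i j x y).det := by
  simp only [Matrix.det_apply', Matrix.of_apply]
  refine SmoothOn.sum fun σ => SmoothOn.const_mul _ ?_
  exact contDiffOn_prod fun i _ => hT _ _

/-- Cramer's rule: the inverse is the adjugate divided by a nowhere vanishing determinant, and both
are polynomial in the g_{ij}. -/
lemma smooth_metricInv (h : LocalFinsler L U) (i j : Fin n) : SmoothOn U (metricInv L i j) := by
  have hdet : SmoothOn U fun x y => (metricMatrix L x y).det := smooth_det h.smooth_metric
  have hadj : SmoothOn U fun x y => (metricMatrix L x y).adjugate i j := by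
    -- An adjugate entry is the determinant of the matrix with row `j` replaced by a standard basis
    -- vector, so `smooth_det` covers it too.
    have : ∀ x y, (metricMatrix L x y).adjugate i j = (Matrix.of fun a b =>
        (if a = j then (fun _ _ => (Pi.single i 1 : Fin n → ℝ) b) else metric L a b) x y).det := by
      intro x y
      rw [Matrix.adjugate_apply]
      congr 1
      ext a b
      by_cases hab : a = j <;> simp [Matrix.updateRow_apply, metricMatrix, hab]
    simp only [this]
    refine smooth_det fun a b => ?_
    split_ifs
    · exact contDiffOn_const
    · exact h.smooth_metric a b
  have hinv : SmoothOn U fun x y => ((metricMatrix L x y).det)⁻¹ :=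
    ContDiffOn.inv hdet fun p hp => h.nondegenerate p.1 p.2 hp
  refine (hinv.mul hadj).congr fun x y _ => ?_
  simp [metricInv, Matrix.inv_def]

lemma smooth_cartan (h : LocalFinsler L U) (i j k : Fin n) : SmoothOn U (cartan L i j k) :=
  (((h.smooth_metric i j).dy h.isOpen k).const_mul (1 / 2)).congr
    fun x y _ => by simp only [cartan]; ring

lemma smooth_cartanUp (h : LocalFinsler L U) (i j k : Fin n) : SmoothOn U (cartanUp L i j k) :=
  SmoothOn.sum fun r => (h.smooth_metricInv r i).mul (h.smooth_cartan r j k)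

lemma smooth_formalChristoffel (h : LocalFinsler L U) (i j k : Fin n) :
    SmoothOn U (formalChristoffel L i j k) :=
  (SmoothOn.sum fun r => (h.smooth_metricInv i r).mul
    ((((h.smooth_metric k r).dx h.isOpen j).add ((h.smooth_metric j r).dx h.isOpen k)).sub
      ((h.smooth_metric j k).dx h.isOpen r))).const_mul _

lemma smooth_spray (h : LocalFinsler L U) (i : Fin n) : SmoothOn U (spray L i) :=
  (SmoothOn.sum fun j => SmoothOn.sum fun k =>
    ((h.smooth_formalChristoffel i j k).mul (smoothOn_coord j)).mul (smoothOn_coord k)).const_mul _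

lemma smooth_nonlinear (h : LocalFinsler L U) (i j : Fin n) : SmoothOn U (nonlinear L i j) :=
  (h.smooth_spray i).dy h.isOpen j

lemma smooth_delta (h : LocalFinsler L U) (k : Fin n) (hA : SmoothOn U A) :
    SmoothOn U (delta L k A) :=
  (hA.dx h.isOpen k).sub (SmoothOn.sum fun r => (h.smooth_nonlinear r k).mul (hA.dy h.isOpen r))

lemma smooth_christoffel (h : LocalFinsler L U) (i j k : Fin n) :
    SmoothOn U (christoffel L i j k) :=
  (SmoothOn.sum fun r => (h.smooth_metricInv i r).mul
    (((h.smooth_delta j (h.smooth_metric k r)).add (h.smooth_delta k (h.smooth_metric j r))).sub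
      (h.smooth_delta r (h.smooth_metric j k)))).const_mul _

lemma metric_symm (h : LocalFinsler L U) (hp : (x, y) ∈ U) (i j : Fin n) :
    metric L i j x y = metric L j i x y := dy_dy_comm h.isOpen hp h.smooth_energy i j

lemma sum_metric_mul_metricInv (h : LocalFinsler L U) (hp : (x, y) ∈ U) (s r : Fin n) :
    ∑ i, metric L s i x y * metricInv L i r x y = if s = r then 1 else 0 := by
  have := congrFun (congrFun (Matrix.mul_nonsing_inv (metricMatrix L x y)
    (isUnit_iff_ne_zero.2 (h.nondegenerate x y hp))) s) r
  simpa [Matrix.mul_apply, metricMatrix, metricInv, Matrix.one_apply] using this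

lemma sum_metricInv_mul_metric (h : LocalFinsler L U) (hp : (x, y) ∈ U) (s r : Fin n) :
    ∑ i, metricInv L s i x y * metric L i r x y = if s = r then 1 else 0 := by
  have := congrFun (congrFun (Matrix.nonsing_inv_mul (metricMatrix L x y)
    (isUnit_iff_ne_zero.2 (h.nondegenerate x y hp))) s) r
  simpa [Matrix.mul_apply, metricMatrix, metricInv, Matrix.one_apply] using this

lemma lower_raise (h : LocalFinsler L U) (hp : (x, y) ∈ U) (T : Fin n → ℝ) (s : Fin n) :
    ∑ i, metric L s i x y * ∑ r, metricInv L i r x y * T r = T s := by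
  simp only [Finset.mul_sum, ← mul_assoc]
  rw [Finset.sum_comm]
  simp only [← Finset.sum_mul, h.sum_metric_mul_metricInv hp]
  simp

/-- Nondegeneracy lets identities with an upper index be checked after lowering it, which keeps the
inverse metric out of later computations. -/
lemma eq_of_lower_eq (h : LocalFinsler L U) (hp : (x, y) ∈ U) {T S : Fin n → ℝ}
    (hTS : ∀ s, ∑ i, metric L s i x y * T i = ∑ i, metric L s i x y * S i) (i : Fin n) :
    T i = S i := by
  have key : ∀ R : Fin n → ℝ, R i = ∑ s, metricInv L i s x y * ∑ j, metric L s j x y * R j := by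
    intro R
    simp only [Finset.mul_sum, ← mul_assoc]
    rw [Finset.sum_comm]
    simp only [← Finset.sum_mul, h.sum_metricInv_mul_metric hp]
    simp
  rw [key T, key S]
  simp only [hTS]

lemma homogeneousOn_energy (h : LocalFinsler L U) : HomogeneousOn U 2 (energy L) := by
  intro x y hp t ht
  simp only [energy, h.homogeneous x y hp t ht]
  ring

lemma homogeneousOn_dy_energy (h : LocalFinsler L U) (i : Fin n) :
    HomogeneousOn U 1 (dy i (energy L)) :=
  h.homogeneousOn_energy.dy h.isOpen h.conic h.smooth_energy i

lemma homogeneousOn_metric (h : LocalFinsler L U) (i j : Fin n) :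
    HomogeneousOn U 0 (metric L i j) :=
  (h.homogeneousOn_dy_energy j).dy h.isOpen h.conic (h.smooth_dy_energy j) i

lemma homogeneousOn_metricInv (h : LocalFinsler L U) (i j : Fin n) :
    HomogeneousOn U 0 (metricInv L i j) := by
  intro x y hp t ht
  have : metricMatrix L x (t • y) = metricMatrix L x y := by
    ext a b
    simpa [metricMatrix] using h.homogeneousOn_metric a b x y hp t ht
  simp [metricInv, this]

lemma homogeneousOn_spray (h : LocalFinsler L U) (i : Fin n) :
    HomogeneousOn U 2 (spray L i) := by
  intro x y hp t ht
  have hd : ∀ a b c, dx a (metric L b c) x (t • y) = dx a (metric L b c) x y := fun a b c => by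
    simpa using (h.homogeneousOn_metric b c).dx h.isOpen (h.smooth_metric b c) a x y hp t ht
  have hi : ∀ a b, metricInv L a b x (t • y) = metricInv L a b x y := fun a b => by
    simpa using h.homogeneousOn_metricInv a b x y hp t ht
  simp only [spray, formalChristoffel, hd, hi, PiLp.smul_apply, smul_eq_mul]
  rw [mul_left_comm]
  congr 1
  simp only [Finset.mul_sum (a := t ^ 2)]
  refine Finset.sum_congr rfl fun j _ => Finset.sum_congr rfl fun k _ => ?_
  ring

lemma homogeneousOn_nonlinear (h : LocalFinsler L U) (i j : Fin n) :
    HomogeneousOn U 1 (nonlinear L i j) :=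
  (h.homogeneousOn_spray i).dy h.isOpen h.conic (h.smooth_spray i) j

/-- `∂̇_k N^i_j = ∂̇_j N^i_k`. -/
lemma dy_nonlinear_symm (h : LocalFinsler L U) (hp : (x, y) ∈ U) (i j k : Fin n) :
    dy k (nonlinear L i j) x y = dy j (nonlinear L i k) x y :=
  dy_dy_comm h.isOpen hp (h.smooth_spray i) k j

lemma sum_coord_nonlinear (h : LocalFinsler L U) (hp : (x, y) ∈ U) (i : Fin n) :
    ∑ j, y j * nonlinear L i j x y = 2 * spray L i x y := by
  simpa [nonlinear] using (h.homogeneousOn_spray i).euler h.isOpen (h.smooth_spray i) hp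

lemma sum_coord_dy_nonlinear (h : LocalFinsler L U) (hp : (x, y) ∈ U) (i j : Fin n) :
    ∑ k, y k * dy k (nonlinear L i j) x y = nonlinear L i j x y := by
  simpa using (h.homogeneousOn_nonlinear i j).euler h.isOpen (h.smooth_nonlinear i j) hp

lemma sum_coord_dy_nonlinear' (h : LocalFinsler L U) (hp : (x, y) ∈ U) (i k : Fin n) :
    ∑ j, y j * dy k (nonlinear L i j) x y = nonlinear L i k x y := by
  simp only [h.dy_nonlinear_symm hp i _ k, h.sum_coord_dy_nonlinear hp]

lemma sum_coord_metric (h : LocalFinsler L U) (hp : (x, y) ∈ U) (j : Fin n) :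
    ∑ k, y k * metric L k j x y = dy j (energy L) x y := by
  simpa [metric] using (h.homogeneousOn_dy_energy j).euler h.isOpen (h.smooth_dy_energy j) hp

/-- Third vertical derivatives of the energy commute; this is the total symmetry of the Cartan
tensor. -/
lemma dy_metric_symm (h : LocalFinsler L U) (hp : (x, y) ∈ U) (i j k : Fin n) :
    dy k (metric L i j) x y = dy i (metric L k j) x y :=
  dy_dy_comm h.isOpen hp (h.smooth_dy_energy j) k i

lemma dy_metric_swap (h : LocalFinsler L U) (hp : (x, y) ∈ U) (i j k : Fin n) :
    dy k (metric L i j) x y = dy k (metric L j i) x y :=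
  (isDirAt_dy h.isOpen hp k).congr (h.smooth_metric j i) fun _ _ hq => h.metric_symm hq i j

lemma sum_coord_dy_metric (h : LocalFinsler L U) (hp : (x, y) ∈ U) (j k : Fin n) :
    ∑ i, y i * dy k (metric L i j) x y = 0 := by
  simp only [h.dy_metric_symm hp _ j k]
  simpa using (h.homogeneousOn_metric k j).euler h.isOpen (h.smooth_metric k j) hp

lemma dx_metric_swap (h : LocalFinsler L U) (hp : (x, y) ∈ U) (i j k : Fin n) :
    dx k (metric L i j) x y = dx k (metric L j i) x y :=
  (isDirAt_dx h.isOpen hp k).congr (h.smooth_metric j i) fun _ _ hq => h.metric_symm hq i j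

lemma delta_metric_swap (h : LocalFinsler L U) (hp : (x, y) ∈ U)
    (L' : Coord n → Coord n → ℝ) (i j k : Fin n) :
    delta L' k (metric L i j) x y = delta L' k (metric L j i) x y :=
  (isDirAt_delta L' h.isOpen hp k).congr (h.smooth_metric j i) fun _ _ hq => h.metric_symm hq i j

lemma sum_coord_dx_metric (h : LocalFinsler L U) (hp : (x, y) ∈ U) (j k : Fin n) :
    ∑ i, y i * dx k (metric L i j) x y = dx k (dy j (energy L)) x y := by
  have := ((h.homogeneousOn_dy_energy j).dx h.isOpen (h.smooth_dy_energy j) k).euler h.isOpen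
    ((h.smooth_dy_energy j).dx h.isOpen k) hp
  simpa [metric, dy_dx_comm h.isOpen hp (h.smooth_dy_energy j)] using this

lemma sum_coord_dx_dy_energy (h : LocalFinsler L U) (hp : (x, y) ∈ U) (k : Fin n) :
    ∑ i, y i * dx k (dy i (energy L)) x y = 2 * dx k (energy L) x y := by
  have := (h.homogeneousOn_energy.dx h.isOpen h.smooth_energy k).euler h.isOpen
    (h.smooth_energy.dx h.isOpen k) hp
  simpa [dy_dx_comm h.isOpen hp h.smooth_energy] using this

/-- `2 g_{si} G^i = y^j ∂_j ∂̇_s E - ∂_s E`. -/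
lemma lower_spray (h : LocalFinsler L U) (hp : (x, y) ∈ U) (s : Fin n) :
    2 * ∑ i, metric L s i x y * spray L i x y
      = ∑ j, y j * dx j (dy s (energy L)) x y - dx s (energy L) x y := by
  -- The constant 1/4 is the product of the factors 1/2 in the spray and in the formal Christoffel
  -- symbols.
  have h1 : ∀ i, spray L i x y = ∑ r, metricInv L i r x y * ((1 / 4) * ∑ j, ∑ k,
      (dx j (metric L k r) x y + dx k (metric L j r) x y - dx r (metric L j k) x y)
        * y j * y k) := by
    intro i
    simp only [spray, formalChristoffel, Finset.mul_sum, Finset.sum_mul]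
    conv_rhs => rw [Finset.sum_comm]
    refine Finset.sum_congr rfl fun j _ => ?_
    conv_rhs => rw [Finset.sum_comm]
    refine Finset.sum_congr rfl fun k _ => Finset.sum_congr rfl fun r _ => ?_
    ring
  simp only [h1, h.lower_raise hp]
  have h2 : ∑ j, ∑ k, dx j (metric L k s) x y * y j * y k
      = ∑ j, y j * dx j (dy s (energy L)) x y := by
    refine Finset.sum_congr rfl fun j _ => ?_
    rw [← h.sum_coord_dx_metric hp, Finset.mul_sum]
    exact Finset.sum_congr rfl fun k _ => by ring
  have h3 : ∑ j, ∑ k, dx k (metric L j s) x y * y j * y k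
      = ∑ j, y j * dx j (dy s (energy L)) x y := by
    rw [← h2, Finset.sum_comm]
    exact Finset.sum_congr rfl fun k _ => Finset.sum_congr rfl fun j _ => by ring
  have h4 : ∑ j, ∑ k, dx s (metric L j k) x y * y j * y k = 2 * dx s (energy L) x y := by
    rw [← h.sum_coord_dx_dy_energy hp, Finset.sum_comm]
    refine Finset.sum_congr rfl fun k _ => ?_
    rw [← h.sum_coord_dx_metric hp, Finset.mul_sum]
    exact Finset.sum_congr rfl fun j _ => by ring
  simp only [add_mul, sub_mul, Finset.sum_add_distrib, Finset.sum_sub_distrib, h2, h3, h4]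
  ring

/-- The derivative of `lower_spray` along `∂̇_k`. -/
lemma lower_nonlinear (h : LocalFinsler L U) (hp : (x, y) ∈ U) (s k : Fin n) :
    2 * (∑ i, dy k (metric L s i) x y * spray L i x y
        + ∑ i, metric L s i x y * nonlinear L i k x y)
      = dx k (dy s (energy L)) x y + ∑ j, y j * dx j (metric L k s) x y
        - dx s (dy k (energy L)) x y := by
  have hD := isDirAt_dy h.isOpen hp k
  have hs : ∀ j, SmoothOn U (dx j (dy s (energy L))) := fun j =>
    (h.smooth_dy_energy s).dx h.isOpen j
  have h1 := hD.congr ((SmoothOn.sum (s := Finset.univ) fun j =>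
    (smoothOn_coord j).mul (hs j)).sub (h.smooth_energy.dx h.isOpen s))
    fun _ _ hq => h.lower_spray hq s
  have h2 := hD.const_mul 2 (SmoothOn.sum (s := Finset.univ) fun i =>
    (h.smooth_metric s i).mul (h.smooth_spray i))
  have h3 := hD.sum_mul (s := Finset.univ) (fun i => h.smooth_metric s i) h.smooth_spray
  have h4 := hD.sub (SmoothOn.sum (s := Finset.univ) fun j =>
    (smoothOn_coord j).mul (hs j)) (h.smooth_energy.dx h.isOpen s)
  have h5 := hD.sum_mul (s := Finset.univ) (fun j => smoothOn_coord j) hs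
  simp only [] at h1 h2 h3 h4 h5
  rw [h2, h3, h4, h5] at h1
  simp only [dy_coord, dy_dx_comm h.isOpen hp h.smooth_energy,
    dy_dx_comm h.isOpen hp (h.smooth_dy_energy s), ite_mul, one_mul, zero_mul,
    Finset.sum_ite_eq', Finset.mem_univ, if_true] at h1
  exact h1

/-- `δ_k E = 0`. -/
lemma delta_energy (h : LocalFinsler L U) (hp : (x, y) ∈ U) (k : Fin n) :
    delta L k (energy L) x y = 0 := by
  -- The differentiated spray identity is contracted with y^s. The term with ∂̇_k g_{si} drops out
  -- by homogeneity, and Euler's relation turns the rest into twice ∂_k E − N^i_k ∂̇_i E, up to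
  -- terms that cancel.
  have h1 : ∑ s, y s * (2 * (∑ i, dy k (metric L s i) x y * spray L i x y
        + ∑ i, metric L s i x y * nonlinear L i k x y)) = _ :=
    Finset.sum_congr rfl fun s _ => by rw [h.lower_nonlinear hp s k]
  have h2 : ∑ s, y s * ∑ i, dy k (metric L s i) x y * spray L i x y = 0 := by
    simp only [Finset.mul_sum, ← mul_assoc]
    rw [Finset.sum_comm]
    simp only [← Finset.sum_mul, h.sum_coord_dy_metric hp]
    simp
  have h3 : ∑ s, y s * ∑ i, metric L s i x y * nonlinear L i k x y
      = ∑ i, nonlinear L i k x y * dy i (energy L) x y := by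
    simp only [Finset.mul_sum, ← mul_assoc]
    rw [Finset.sum_comm]
    simp only [← Finset.sum_mul, h.sum_coord_metric hp]
    simp only [mul_comm]
  have h4 : ∑ s, y s * ∑ j, y j * dx j (metric L k s) x y
      = ∑ j, y j * dx j (dy k (energy L)) x y := by
    simp only [Finset.mul_sum, ← h.sum_coord_dx_metric hp]
    rw [Finset.sum_comm]
    refine Finset.sum_congr rfl fun j _ => Finset.sum_congr rfl fun s _ => ?_
    rw [h.dx_metric_swap hp k s]
    ring
  have h5 : ∑ s, y s * (2 * (∑ i, dy k (metric L s i) x y * spray L i x y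
        + ∑ i, metric L s i x y * nonlinear L i k x y))
      = 2 * (∑ s, y s * ∑ i, dy k (metric L s i) x y * spray L i x y)
        + 2 * ∑ s, y s * ∑ i, metric L s i x y * nonlinear L i k x y := by
    rw [Finset.mul_sum, Finset.mul_sum, ← Finset.sum_add_distrib]
    exact Finset.sum_congr rfl fun s _ => by ring
  rw [h5, h2, h3] at h1
  simp only [mul_add, mul_sub, Finset.sum_add_distrib, Finset.sum_sub_distrib, h4,
    h.sum_coord_dx_dy_energy hp] at h1
  simp only [delta]
  linarith

/-- The commutator of `∂̇_i` and `δ_k`. -/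
lemma dy_delta (h : LocalFinsler L U) (hp : (x, y) ∈ U) (hA : SmoothOn U A) (i k : Fin n) :
    dy i (delta L k A) x y
      = delta L k (dy i A) x y - ∑ r, dy i (nonlinear L r k) x y * dy r A x y := by
  have hD := isDirAt_dy h.isOpen hp i
  have h1 := hD.sub (hA.dx h.isOpen k) (SmoothOn.sum (s := Finset.univ) fun r =>
    (h.smooth_nonlinear r k).mul (hA.dy h.isOpen r))
  have h2 := hD.sum_mul (s := Finset.univ) (fun r => h.smooth_nonlinear r k)
    (fun r => hA.dy h.isOpen r)
  have h3 : dy i (delta L k A) x y = _ := h1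
  rw [h3, h2, dy_dx_comm h.isOpen hp hA]
  simp only [delta, dy_dy_comm h.isOpen hp hA i]
  ring

end LocalFinsler

end LocalFinsler

/-! ### The Cartan connection and the vanishing of the (v)hv-torsion. -/

section CartanConnection

variable {n : ℕ} {U : Set (Coord n × Coord n)} {L L' A : Coord n → Coord n → ℝ} {x y : Coord n}

namespace LocalFinsler

/-- One vertical derivative of δ_k A = 0, with ∂̇_i moved past δ_k by the commutator `dy_delta`. `A`
is left general so that it can be the energy of `L` or that of another metric. -/
lemma delta_dy_of_delta_eq_zero (h : LocalFinsler L U) (hA : SmoothOn U A)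
    (h0 : ∀ x y, (x, y) ∈ U → ∀ k, delta L k A x y = 0) (hp : (x, y) ∈ U) (i k : Fin n) :
    delta L k (dy i A) x y = ∑ r, dy i (nonlinear L r k) x y * dy r A x y := by
  have hD := isDirAt_dy h.isOpen hp i
  have h1 := hD.congr (B := fun _ _ => 0) contDiffOn_const fun x y hq => h0 x y hq k
  have h2 : dy i (delta L k A) x y = 0 := h1.trans (hD.const 0)
  rw [h.dy_delta hp hA] at h2
  linarith

/-- A second vertical derivative. For an energy `A`, the outer sums say how the Berwald coefficients
act on its metric; the middle sum, the Berwald curvature paired with ∂̇A, is the obstruction to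
their being metric. -/
lemma delta_dy_dy_of_delta_eq_zero (h : LocalFinsler L U) (hA : SmoothOn U A)
    (h0 : ∀ x y, (x, y) ∈ U → ∀ k, delta L k A x y = 0) (hp : (x, y) ∈ U) (i j k : Fin n) :
    delta L k (dy j (dy i A)) x y
      = ∑ r, dy j (nonlinear L r k) x y * dy r (dy i A) x y
        + ∑ r, dy j (dy i (nonlinear L r k)) x y * dy r A x y
        + ∑ r, dy i (nonlinear L r k) x y * dy j (dy r A) x y := by
  have hD := isDirAt_dy h.isOpen hp j
  have hN : ∀ r, SmoothOn U (dy i (nonlinear L r k)) := fun r =>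
    (h.smooth_nonlinear r k).dy h.isOpen i
  have hAr : ∀ r, SmoothOn U (dy r A) := hA.dy h.isOpen
  have h1 := hD.congr (SmoothOn.sum (s := Finset.univ) fun r => (hN r).mul (hAr r))
    fun x y hq => h.delta_dy_of_delta_eq_zero hA h0 hq i k
  have h2 := h1.trans (hD.sum_mul hN hAr)
  have h3 := h.dy_delta hp (hAr i) j k
  linarith

lemma delta_dy_energy_symm (h : LocalFinsler L U) (hp : (x, y) ∈ U) (i k : Fin n) :
    delta L k (dy i (energy L)) x y = delta L i (dy k (energy L)) x y := by
  rw [h.delta_dy_of_delta_eq_zero h.smooth_energy (fun x y => h.delta_energy) hp,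
    h.delta_dy_of_delta_eq_zero h.smooth_energy (fun x y => h.delta_energy) hp]
  simp only [h.dy_nonlinear_symm hp _ k i]

/-- The form in which Γ is used throughout: the Christoffel formula with its index lowered and no
inverse metric. -/
lemma lower_christoffel (h : LocalFinsler L U) (hp : (x, y) ∈ U) (s j k : Fin n) :
    ∑ i, metric L s i x y * christoffel L i j k x y
      = (delta L j (metric L k s) x y + delta L k (metric L j s) x y
        - delta L s (metric L j k) x y) / 2 := by
  rw [← h.lower_raise hp (fun s => (delta L j (metric L k s) x y + delta L k (metric L j s) x y
        - delta L s (metric L j k) x y) / 2) s]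
  refine Finset.sum_congr rfl fun i _ => ?_
  simp only [christoffel, Finset.mul_sum]
  exact Finset.sum_congr rfl fun r _ => by ring

lemma christoffel_symm (h : LocalFinsler L U) (hp : (x, y) ∈ U) (i j k : Fin n) :
    christoffel L i j k x y = christoffel L i k j x y := by
  simp only [christoffel, h.delta_metric_swap hp L j k]
  congr 1
  exact Finset.sum_congr rfl fun r _ => by ring

/-- The horizontal covariant derivative of the metric vanishes. -/
lemma delta_metric (h : LocalFinsler L U) (hp : (x, y) ∈ U) (i j k : Fin n) :
    delta L k (metric L i j) x y = ∑ r, metric L j r x y * christoffel L r i k x y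
      + ∑ r, metric L i r x y * christoffel L r j k x y := by
  rw [h.lower_christoffel hp, h.lower_christoffel hp, h.delta_metric_swap hp L k j,
    h.delta_metric_swap hp L k i, h.delta_metric_swap hp L j i]
  ring

lemma sum_coord_delta_metric (h : LocalFinsler L U) (hp : (x, y) ∈ U) (s k : Fin n) :
    ∑ j, y j * delta L k (metric L j s) x y
      = delta L k (dy s (energy L)) x y + ∑ j, nonlinear L j k x y * metric L j s x y := by
  have hD := isDirAt_delta L h.isOpen hp k
  have h1 := hD.congr (A := dy s (energy L)) (SmoothOn.sum (s := Finset.univ) fun j =>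
    (smoothOn_coord j).mul (h.smooth_metric j s)) fun _ _ hq => (h.sum_coord_metric hq s).symm
  have h2 := hD.sum_mul (s := Finset.univ) (fun j => smoothOn_coord j)
    (fun j => h.smooth_metric j s)
  simp only [] at h1 h2
  rw [h2] at h1
  simp only [delta_coord, neg_mul, Finset.sum_neg_distrib] at h1
  linarith

/-- `y^j Γ^i_{jk} = N^i_k`. -/
lemma sum_coord_christoffel (h : LocalFinsler L U) (hp : (x, y) ∈ U) (i k : Fin n) :
    ∑ j, y j * christoffel L i j k x y = nonlinear L i k x y := by
  refine h.eq_of_lower_eq hp (T := fun i => ∑ j, y j * christoffel L i j k x y)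
    (S := fun i => nonlinear L i k x y) (fun s => ?_) i
  have h1 : ∑ i, metric L s i x y * ∑ j, y j * christoffel L i j k x y
      = (∑ j, y j * delta L j (metric L k s) x y + ∑ j, y j * delta L k (metric L j s) x y
        - ∑ j, y j * delta L s (metric L j k) x y) / 2 := by
    rw [← Finset.sum_add_distrib, ← Finset.sum_sub_distrib, Finset.sum_div]
    simp only [Finset.mul_sum]
    rw [Finset.sum_comm]
    refine Finset.sum_congr rfl fun j _ => ?_
    rw [← mul_add, ← mul_sub, mul_div_assoc, ← h.lower_christoffel hp, Finset.mul_sum]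
    exact Finset.sum_congr rfl fun i _ => by ring
  -- Since y^j N^r_j = 2G^r, the vertical part of y^j δ_j becomes a spray term, the one occurring in
  -- `lower_nonlinear`.
  have h2 : ∑ j, y j * delta L j (metric L k s) x y
      = ∑ j, y j * dx j (metric L k s) x y
        - 2 * ∑ i, dy k (metric L s i) x y * spray L i x y := by
    have : ∑ j, y j * ∑ r, nonlinear L r j x y * dy r (metric L k s) x y
        = 2 * ∑ i, dy k (metric L s i) x y * spray L i x y := by
      simp only [Finset.mul_sum, ← mul_assoc]
      rw [Finset.sum_comm]
      simp only [← Finset.sum_mul, h.sum_coord_nonlinear hp]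
      refine Finset.sum_congr rfl fun r _ => ?_
      rw [h.dy_metric_swap hp s r k, h.dy_metric_symm hp r s k]
      ring
    rw [← this, ← Finset.sum_sub_distrib]
    exact Finset.sum_congr rfl fun j _ => by simp only [delta]; ring
  have h3 := h.lower_nonlinear hp s k
  -- The symmetry of δ_k ∂̇_s E in k and s cancels these terms in the difference of the two
  -- remaining contractions, leaving only N contracted with g.
  have h4 := h.delta_dy_energy_symm hp s k
  have h5 := h4
  simp only [delta] at h5
  have h6 : ∑ i, nonlinear L i k x y * metric L i s x y
      = ∑ i, metric L s i x y * nonlinear L i k x y :=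
    Finset.sum_congr rfl fun i _ => by rw [h.metric_symm hp i s, mul_comm]
  change dx k (dy s (energy L)) x y - ∑ r, nonlinear L r k x y * metric L r s x y
    = dx s (dy k (energy L)) x y - ∑ r, nonlinear L r s x y * metric L r k x y at h5
  rw [h1, h2, h.sum_coord_delta_metric hp, h.sum_coord_delta_metric hp]
  linarith

/-- A metric whose energy is horizontally constant for `L` has the spray of `L`. -/
lemma spray_eq (h : LocalFinsler L U) (h' : LocalFinsler L' U)
    (h0 : ∀ x y, (x, y) ∈ U → ∀ k, delta L k (energy L') x y = 0) (hp : (x, y) ∈ U) (i : Fin n) :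
    spray L' i x y = spray L i x y := by
  refine h'.eq_of_lower_eq hp (T := fun i => spray L' i x y) (S := fun i => spray L i x y)
    (fun s => ?_) i
  have h1 := h'.lower_spray hp s
  -- All x-derivatives of E' are rewritten through N. After contraction with y^j, the relation y^j
  -- ∂̇_s N^r_j = N^r_s makes the terms in ∂̇_r E' cancel, and y^j N^r_j = 2G^r leaves the lowered
  -- spray of `L`.
  have h2 : ∀ j, dx j (dy s (energy L')) x y
      = ∑ r, dy s (nonlinear L r j) x y * dy r (energy L') x y
        + ∑ r, nonlinear L r j x y * metric L' r s x y := by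
    intro j
    have := h.delta_dy_of_delta_eq_zero h'.smooth_energy h0 hp s j
    simp only [delta] at this
    simp only [metric]
    linarith
  have h3 : dx s (energy L') x y = ∑ r, nonlinear L r s x y * dy r (energy L') x y := by
    have := h0 x y hp s
    simp only [delta] at this
    linarith
  simp only [h2, h3, mul_add, Finset.sum_add_distrib, Finset.mul_sum, ← mul_assoc] at h1
  rw [Finset.sum_comm, Finset.sum_comm (f := fun j r => y j * nonlinear L r j x y * _)] at h1
  simp only [← Finset.sum_mul, h.sum_coord_dy_nonlinear' hp, h.sum_coord_nonlinear hp] at h1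
  have h4 : ∑ r, 2 * spray L r x y * metric L' r s x y
      = 2 * ∑ r, metric L' s r x y * spray L r x y := by
    rw [Finset.mul_sum]
    exact Finset.sum_congr rfl fun r _ => by rw [h'.metric_symm hp r s]; ring
  rw [h4] at h1
  simp only [mul_assoc, ← Finset.mul_sum] at h1
  linarith

lemma nonlinear_eq (h : LocalFinsler L U) (h' : LocalFinsler L' U)
    (h0 : ∀ x y, (x, y) ∈ U → ∀ k, delta L k (energy L') x y = 0) (hp : (x, y) ∈ U)
    (i j : Fin n) : nonlinear L' i j x y = nonlinear L i j x y :=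
  (isDirAt_dy h.isOpen hp j).congr (h.smooth_spray i) fun _ _ hq => h.spray_eq h' h0 hq i

lemma delta_eq (h : LocalFinsler L U) (h' : LocalFinsler L' U)
    (h0 : ∀ x y, (x, y) ∈ U → ∀ k, delta L k (energy L') x y = 0) (hp : (x, y) ∈ U)
    (k : Fin n) : delta L' k A x y = delta L k A x y := by
  simp only [delta, h.nonlinear_eq h' h0 hp]

/-- If the energy of `L'` is horizontally constant for `L`, and its vertical differential annihilates
the Berwald hv-curvature of `L`, then `L'` is Landsberg. -/
lemma hvTorsion_eq_zero (h : LocalFinsler L U) (h' : LocalFinsler L' U)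
    (h0 : ∀ x y, (x, y) ∈ U → ∀ k, delta L k (energy L') x y = 0) (hp : (x, y) ∈ U)
    (hB : ∀ i j k, ∑ r, dy j (dy i (nonlinear L r k)) x y * dy r (energy L') x y = 0)
    (i j k : Fin n) : hvTorsion L' i j k x y = 0 := by
  have h1 : dy k (nonlinear L' i j) x y = dy k (nonlinear L i j) x y :=
    (isDirAt_dy h.isOpen hp k).congr (h.smooth_nonlinear i j)
      fun _ _ hq => h.nonlinear_eq h' h0 hq i j
  rw [hvTorsion, h1, sub_eq_zero]
  refine h'.eq_of_lower_eq hp (T := fun i => dy k (nonlinear L i j) x y)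
    (S := fun i => christoffel L' i j k x y) (fun s => ?_) i
  -- With the curvature term removed by `hB`, the Berwald coefficients are metric for g'. As they
  -- are also symmetric, the usual cyclic combination identifies them with the Christoffel symbols
  -- of `L'`.
  have h2 : ∀ i j k, delta L k (metric L' i j) x y
      = ∑ r, dy i (nonlinear L r k) x y * metric L' r j x y
        + ∑ r, dy j (nonlinear L r k) x y * metric L' r i x y := by
    intro i j k
    have := h.delta_dy_dy_of_delta_eq_zero h'.smooth_energy h0 hp j i k
    rw [hB, add_zero] at this
    simp only [h'.metric_symm hp _ i]
    exact this
  rw [h'.lower_christoffel hp]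
  simp only [h.delta_eq h' h0 hp, h2, h.dy_nonlinear_symm hp _ j k, h.dy_nonlinear_symm hp _ s k,
    h.dy_nonlinear_symm hp _ s j, h'.metric_symm hp _ s]
  have h3 : ∑ r, dy j (nonlinear L r k) x y * metric L' s r x y
      = ∑ r, metric L' s r x y * dy j (nonlinear L r k) x y :=
    Finset.sum_congr rfl fun r _ => mul_comm _ _
  linarith

/-- In the Landsberg case the Berwald and Cartan coefficients agree; this is the main way the
torsion hypothesis is used. -/
lemma dy_nonlinear_eq_christoffel
    (hP : ∀ x y, (x, y) ∈ U → ∀ i j k, hvTorsion L i j k x y = 0) (hp : (x, y) ∈ U)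
    (i j k : Fin n) : dy k (nonlinear L i j) x y = christoffel L i j k x y :=
  sub_eq_zero.1 (hP x y hp i j k)

/-- The Cartan coefficients always preserve g, while the Berwald ones preserve it up to exactly this
sum. In the Landsberg case the two sets coincide, so the sum is zero. -/
lemma sum_dy_dy_nonlinear_mul_dy_energy (h : LocalFinsler L U)
    (hP : ∀ x y, (x, y) ∈ U → ∀ i j k, hvTorsion L i j k x y = 0) (hp : (x, y) ∈ U)
    (i j k : Fin n) :
    ∑ r, dy j (dy i (nonlinear L r k)) x y * dy r (energy L) x y = 0 := by
  have h1 := h.delta_dy_dy_of_delta_eq_zero h.smooth_energy (fun x y => h.delta_energy) hp i j k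
  have h2 := h.delta_metric hp j i k
  simp only [dy_nonlinear_eq_christoffel hP hp] at h1
  change delta L k (metric L j i) x y = ∑ r, christoffel L r k j x y * metric L r i x y + _
    + ∑ r, christoffel L r k i x y * metric L j r x y at h1
  simp only [h.christoffel_symm hp _ k, h.metric_symm hp _ i] at h1
  have h3 : ∀ a b, ∑ r, christoffel L r a k x y * metric L b r x y
      = ∑ r, metric L b r x y * christoffel L r a k x y :=
    fun a b => Finset.sum_congr rfl fun r _ => mul_comm _ _
  rw [h3, h3] at h1
  linarith

lemma dir_energy (h : LocalFinsler L U) {D : (Coord n → Coord n → ℝ) → ℝ}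
    (hD : IsDirAt U x y D) : D (energy L) = L x y * D L := by
  have h1 := hD.congr (A := energy L) ((h.smooth.mul h.smooth).const_mul (1 / 2))
    fun x y _ => by simp only [energy]; ring
  rw [h1, hD.const_mul _ (h.smooth.mul h.smooth), hD.mul h.smooth h.smooth]
  ring

/-- A Landsberg metric stays Landsberg if it is replaced by a function of itself and of a
Cartan-parallel one-form. -/
theorem hvTorsion_eq_zero_of_change (h : LocalFinsler L U) (h' : LocalFinsler L' U)
    {c : Fin n → Coord n → ℝ} (hc : ∀ i, SmoothOn U fun x _ => c i x)
    (hpar : ∀ x y, (x, y) ∈ U → ∀ i j, hcovCovector L (fun i x _ => c i x) i j x y = 0)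
    (hdir : ∀ x y, (x, y) ∈ U → ∀ v, dir v L x y = 0 →
      dir v (fun x y => ∑ i, c i x * y i) x y = 0 → dir v L' x y = 0)
    (hP : ∀ x y, (x, y) ∈ U → ∀ i j k, hvTorsion L i j k x y = 0) (hp : (x, y) ∈ U)
    (i j k : Fin n) : hvTorsion L' i j k x y = 0 := by
  have hbeta : SmoothOn U (fun x y => ∑ i, c i x * y i) :=
    SmoothOn.sum fun i => (hc i).mul (smoothOn_coord i)
  have hpar' : ∀ x y, (x, y) ∈ U → ∀ i j,
      delta L j (fun x _ => c i x) x y = ∑ r, c r x * christoffel L r i j x y :=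
    fun x y hq i j => sub_eq_zero.1 (hpar x y hq i j)
  refine h.hvTorsion_eq_zero h' (fun x y hp k => ?_) hp (fun i j k => ?_) i j k
  · have hD := isDirAt_delta L h.isOpen hp k
    -- δ_k E = L δ_k L, and L is positive.
    have h1 : delta L k L x y = 0 := by
      have := h.dir_energy hD
      simp only [h.delta_energy hp] at this
      exact (mul_eq_zero.1 this.symm).resolve_left (h.pos x y hp).ne'
    have h2 : delta L k (fun x y => ∑ i, c i x * y i) x y = 0 := by
      have h3 := hD.sum_mul (s := Finset.univ) hc (fun i => smoothOn_coord i)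
      simp only [] at h3
      rw [h3]
      -- δ_k b_i contributes y^i b_r Γ^r_{ik} = b_r N^r_k, which cancels against b_r δ_k y^r = −b_r
      -- N^r_k.
      simp only [hpar' x y hp, delta_coord, Finset.sum_mul]
      rw [Finset.sum_comm, ← Finset.sum_add_distrib]
      refine Finset.sum_eq_zero fun r _ => ?_
      rw [← h.sum_coord_christoffel hp, ← Finset.sum_neg_distrib, Finset.mul_sum,
        ← Finset.sum_add_distrib]
      exact Finset.sum_eq_zero fun i _ => by ring
    rw [delta_eq_dir L h.isOpen hp h.smooth] at h1
    rw [delta_eq_dir L h.isOpen hp hbeta] at h2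
    have h3 := h'.dir_energy hD
    rw [h3, delta_eq_dir L h.isOpen hp h'.smooth, hdir x y hp _ h1 h2, mul_zero]
  -- For fixed i, j, k the Berwald curvature is read as the components of a vertical vector, so
  -- `hdir` applies to it just as to the horizontal lift above.
  · have hv : ∀ A, SmoothOn U A →
        dir (0, ∑ r, dy j (dy i (nonlinear L r k)) x y • basisVec r) A x y
          = ∑ r, dy j (dy i (nonlinear L r k)) x y * dy r A x y := by
      intro A hA
      rw [dir_sum_right]
      simp only [← dy_eq_dir h.isOpen hp hA]
      simp only [dir, add_eq_right]
      exact map_zero _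
    have hE : ∀ {L : Coord n → Coord n → ℝ} (h : LocalFinsler L U) (w : Fin n → ℝ),
        ∑ r, w r * dy r (energy L) x y = L x y * ∑ r, w r * dy r L x y := by
      intro L h w
      rw [Finset.mul_sum]
      refine Finset.sum_congr rfl fun r _ => ?_
      have := h.dir_energy (isDirAt_dy h.isOpen hp r)
      rw [this]
      ring
    have h1 : ∑ r, dy j (dy i (nonlinear L r k)) x y * dy r L x y = 0 := by
      have := h.sum_dy_dy_nonlinear_mul_dy_energy hP hp i j k
      rw [hE h] at this
      exact (mul_eq_zero.1 this).resolve_left (h.pos x y hp).ne'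
    have h2 : ∀ r, dy r (fun x y => ∑ i, c i x * y i) x y = c r x := by
      intro r
      have := (isDirAt_dy h.isOpen hp r).sum_mul (s := Finset.univ) hc (fun i => smoothOn_coord i)
      simp only [] at this
      rw [this]
      simp only [dy_eq_zero, dy_coord]
      simp
    have h3 : ∑ r, dy j (dy i (nonlinear L r k)) x y * c r x = 0 := by
      have hD := isDirAt_dy h.isOpen hp j
      -- By the Landsberg condition, parallelism becomes ∂_i b_k = b_r ∂̇_i N^r_k. The left side is
      -- independent of y, so applying ∂̇_j annihilates it and leaves b_r G^r_{ijk} = 0.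
      have h4 : ∀ x y, (x, y) ∈ U → dx i (fun x _ => c k x) x y
          = ∑ r, c r x * dy i (nonlinear L r k) x y := by
        intro x y hq
        simp only [dy_nonlinear_eq_christoffel hP hq, ← hpar' x y hq, delta, dy_eq_zero]
        simp
      have hN : ∀ r, SmoothOn U (dy i (nonlinear L r k)) :=
        fun r => (h.smooth_nonlinear r k).dy h.isOpen i
      have h5 := hD.congr (SmoothOn.sum (s := Finset.univ) fun r => (hc r).mul (hN r)) h4
      have h6 := hD.sum_mul (s := Finset.univ) hc hN
      have h7 : dy j (dx i (fun x _ => c k x)) x y = 0 :=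
        dy_eq_zero (fun x => fderiv ℝ (fun x' => c k x') x (basisVec i)) j x y
      rw [h7, h6] at h5
      simp only [dy_eq_zero, zero_mul, Finset.sum_const_zero, zero_add] at h5
      simpa only [mul_comm] using h5.symm
    rw [hE h', ← hv L' h'.smooth, hdir x y hp _ _ _, mul_zero]
    · rw [hv L h.smooth, h1]
    · rw [hv _ hbeta]
      simp only [h2, h3]

end LocalFinsler

end CartanConnection

/-! ### The hv-curvature and its equivalence with the torsion condition. -/

section HvCurvature

variable {n : ℕ} {U : Set (Coord n × Coord n)} {L : Coord n → Coord n → ℝ} {x y : Coord n}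

namespace LocalFinsler

lemma cartan_symm (h : LocalFinsler L U) (hp : (x, y) ∈ U) (i j k : Fin n) :
    cartan L i j k x y = cartan L k j i x y := by
  simp only [cartan, h.dy_metric_symm hp i j k]

lemma cartan_swap (h : LocalFinsler L U) (hp : (x, y) ∈ U) (i j k : Fin n) :
    cartan L i j k x y = cartan L j i k x y := by
  simp only [cartan, h.dy_metric_swap hp i j k]

lemma lower_cartanUp (h : LocalFinsler L U) (hp : (x, y) ∈ U) (s j k : Fin n) :
    ∑ i, metric L s i x y * cartanUp L i j k x y = cartan L s j k x y := by
  simp only [cartanUp, Finset.mul_sum]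
  rw [Finset.sum_comm]
  have : ∀ r, ∑ i, metric L s i x y * (metricInv L r i x y * cartan L r j k x y)
      = (if r = s then 1 else 0) * cartan L r j k x y := by
    intro r
    rw [← h.sum_metricInv_mul_metric hp, Finset.sum_mul]
    exact Finset.sum_congr rfl fun i _ => by rw [h.metric_symm hp s i]; ring
  simp only [this]
  simp

lemma sum_coord_cartanUp (h : LocalFinsler L U) (hp : (x, y) ∈ U) (i k : Fin n) :
    ∑ j, y j * cartanUp L i j k x y = 0 := by
  have h1 : ∀ r, ∑ j, y j * cartan L r j k x y = 0 := by
    intro r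
    simp only [cartan, h.dy_metric_swap hp r, ← mul_div_assoc, ← Finset.sum_div,
      h.sum_coord_dy_metric hp, zero_div]
  simp only [cartanUp, Finset.mul_sum, mul_left_comm]
  rw [Finset.sum_comm]
  simp only [← Finset.mul_sum, h1, mul_zero, Finset.sum_const_zero]

/-- The field y is horizontally parallel, as δ_j y^a = −N^a_j = −y^r Γ^a_{rj}. Contraction with it
therefore commutes with the covariant derivative, and y^a C^i_{ak} = 0. -/
lemma sum_coord_hcovCartanUp (h : LocalFinsler L U) (hp : (x, y) ∈ U) (i j k : Fin n) :
    ∑ a, y a * hcovCartanUp L i a k j x y = 0 := by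
  have hD := isDirAt_delta L h.isOpen hp j
  have h1 := hD.congr (B := fun _ _ => 0) contDiffOn_const
    fun _ _ hq => h.sum_coord_cartanUp hq i k
  have h2 := hD.sum_mul (s := Finset.univ) (fun a => smoothOn_coord a)
    (fun a => h.smooth_cartanUp i a k)
  have h3 := hD.const 0
  simp only [] at h1 h2 h3
  rw [h2, h3] at h1
  simp only [delta_coord] at h1
  have h4 : ∑ a, y a * ∑ r, cartanUp L r a k x y * christoffel L i r j x y = 0 := by
    simp only [Finset.mul_sum, ← mul_assoc]
    rw [Finset.sum_comm]
    simp only [← Finset.sum_mul, h.sum_coord_cartanUp hp, zero_mul, Finset.sum_const_zero]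
  have h5 : ∑ a, y a * ∑ r, cartanUp L i r k x y * christoffel L r a j x y
      = ∑ r, cartanUp L i r k x y * nonlinear L r j x y := by
    simp only [Finset.mul_sum, mul_left_comm (y _)]
    rw [Finset.sum_comm]
    simp only [← Finset.mul_sum, h.sum_coord_christoffel hp]
  have h6 : ∑ a, y a * ∑ r, cartanUp L i a r x y * christoffel L r k j x y = 0 := by
    simp only [Finset.mul_sum, ← mul_assoc]
    rw [Finset.sum_comm]
    simp only [← Finset.sum_mul, h.sum_coord_cartanUp hp, zero_mul, Finset.sum_const_zero]
  simp only [hcovCartanUp, mul_add, mul_sub, Finset.sum_add_distrib, Finset.sum_sub_distrib,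
    h4, h5, h6]
  simp only [neg_mul, Finset.sum_neg_distrib, mul_comm (nonlinear L _ _ x y)] at h1
  linarith

/-- `y^h P^i_{hjk} = P^i_{jk}`. -/
lemma sum_coord_hvCurvature (h : LocalFinsler L U) (hp : (x, y) ∈ U) (i j k : Fin n) :
    ∑ a, y a * hvCurvature L i a j k x y = hvTorsion L i j k x y := by
  have hD := isDirAt_dy h.isOpen hp k
  -- Applying ∂̇_k to y^a Γ^i_{aj} = N^i_j gives Γ^i_{kj} + y^a ∂̇_k Γ^i_{aj} = ∂̇_k N^i_j.
  have h1 := hD.congr (A := nonlinear L i j) (SmoothOn.sum (s := Finset.univ) fun a =>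
    (smoothOn_coord a).mul (h.smooth_christoffel i a j))
    fun _ _ hq => (h.sum_coord_christoffel hq i j).symm
  have h2 := hD.sum_mul (s := Finset.univ) (fun a => smoothOn_coord a)
    (fun a => h.smooth_christoffel i a j)
  simp only [] at h1 h2
  rw [h2] at h1
  simp only [dy_coord, ite_mul, one_mul, zero_mul, Finset.sum_ite_eq', Finset.mem_univ,
    if_true] at h1
  have h3 : ∑ a, y a * ∑ m, cartanUp L i a m x y * hvTorsion L m j k x y = 0 := by
    simp only [Finset.mul_sum, ← mul_assoc]
    rw [Finset.sum_comm]
    simp only [← Finset.sum_mul, h.sum_coord_cartanUp hp, zero_mul, Finset.sum_const_zero]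
  simp only [hvCurvature, mul_add, mul_sub, Finset.sum_add_distrib, Finset.sum_sub_distrib,
    h3, h.sum_coord_hcovCartanUp hp]
  rw [hvTorsion, h1, h.christoffel_symm hp i k j]
  ring

/-- Since g is horizontally parallel, lowering an index commutes with the covariant derivative. -/
lemma lower_hcovCartanUp (h : LocalFinsler L U) (hp : (x, y) ∈ U) (s a k j : Fin n) :
    ∑ i, metric L s i x y * hcovCartanUp L i a k j x y
      = delta L j (cartan L s a k) x y - ∑ r, cartan L r a k x y * christoffel L r s j x y
        - ∑ r, cartan L s r k x y * christoffel L r a j x y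
        - ∑ r, cartan L s a r x y * christoffel L r k j x y := by
  have hD := isDirAt_delta L h.isOpen hp j
  have h1 := hD.congr (A := cartan L s a k) (SmoothOn.sum (s := Finset.univ) fun i =>
    (h.smooth_metric s i).mul (h.smooth_cartanUp i a k))
    fun _ _ hq => (h.lower_cartanUp hq s a k).symm
  have h2 := hD.sum_mul (s := Finset.univ) (fun i => h.smooth_metric s i)
    (fun i => h.smooth_cartanUp i a k)
  rw [h2] at h1
  simp only [h.delta_metric hp, add_mul, Finset.sum_add_distrib, Finset.sum_mul] at h1
  have h3 : ∑ i, ∑ r, metric L i r x y * christoffel L r s j x y * cartanUp L i a k x y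
      = ∑ r, cartan L r a k x y * christoffel L r s j x y := by
    rw [Finset.sum_comm]
    refine Finset.sum_congr rfl fun r _ => ?_
    rw [← h.lower_cartanUp hp, Finset.sum_mul]
    exact Finset.sum_congr rfl fun i _ => by rw [h.metric_symm hp r i]; ring
  have h4 : ∑ i, ∑ r, metric L s r x y * christoffel L r i j x y * cartanUp L i a k x y
      = ∑ i, metric L s i x y * ∑ r, cartanUp L r a k x y * christoffel L i r j x y := by
    rw [Finset.sum_comm]
    refine Finset.sum_congr rfl fun r _ => ?_
    rw [Finset.mul_sum]
    exact Finset.sum_congr rfl fun i _ => by ring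
  have h5 : ∑ i, metric L s i x y * ∑ r, cartanUp L i r k x y * christoffel L r a j x y
      = ∑ r, cartan L s r k x y * christoffel L r a j x y := by
    simp only [Finset.mul_sum, ← mul_assoc]
    rw [Finset.sum_comm]
    simp only [← Finset.sum_mul, h.lower_cartanUp hp]
  have h6 : ∑ i, metric L s i x y * ∑ r, cartanUp L i a r x y * christoffel L r k j x y
      = ∑ r, cartan L s a r x y * christoffel L r k j x y := by
    simp only [Finset.mul_sum, ← mul_assoc]
    rw [Finset.sum_comm]
    simp only [← Finset.sum_mul, h.lower_cartanUp hp]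
  simp only [hcovCartanUp, mul_add, mul_sub, Finset.sum_add_distrib, Finset.sum_sub_distrib,
    h5, h6]
  linarith

lemma dy_christoffel_eq
    (hU : IsOpen U) (hN : ∀ i j, SmoothOn U (nonlinear L i j))
    (hP : ∀ x y, (x, y) ∈ U → ∀ i j k, hvTorsion L i j k x y = 0) (hp : (x, y) ∈ U)
    (r a b c : Fin n) : dy c (christoffel L r a b) x y = dy c (dy b (nonlinear L r a)) x y :=
  (isDirAt_dy hU hp c).congr ((hN r a).dy hU b)
    fun _ _ hq => (dy_nonlinear_eq_christoffel hP hq r a b).symm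

/-- For a Landsberg metric the horizontal covariant derivative of the Cartan tensor is half the
symmetrized Berwald hv-curvature. -/
lemma hcov_cartan_eq (h : LocalFinsler L U)
    (hP : ∀ x y, (x, y) ∈ U → ∀ i j k, hvTorsion L i j k x y = 0) (hp : (x, y) ∈ U)
    (i j l k : Fin n) :
    2 * (delta L k (cartan L i j l) x y - ∑ r, cartan L r j l x y * christoffel L r i k x y
        - ∑ r, cartan L i r l x y * christoffel L r j k x y
        - ∑ r, cartan L i j r x y * christoffel L r l k x y)
      = ∑ r, metric L j r x y * dy l (christoffel L r i k) x y
        + ∑ r, metric L i r x y * dy l (christoffel L r j k) x y := by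
  have hD := isDirAt_dy h.isOpen hp l
  have hg := h.smooth_metric
  have hG := h.smooth_christoffel
  have hs : ∀ a b, SmoothOn U fun x y => ∑ r, metric L a r x y * christoffel L r b k x y :=
    fun a b => SmoothOn.sum fun r => (hg a r).mul (hG r b k)
  -- Metric compatibility is differentiated along ∂̇_l. The commutator of ∂̇_l and δ_k contributes
  -- ∂̇_l N^r_k = Γ^r_{kl}, the connection term for the third index of C_{ijl}.
  have h1 := hD.congr ((hs j i).add (hs i j)) fun _ _ hq => h.delta_metric hq i j k
  have h2 := hD.add (hs j i) (hs i j)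
  have h3 := hD.sum_mul (s := Finset.univ) (hg j) (fun r => hG r i k)
  have h4 := hD.sum_mul (s := Finset.univ) (hg i) (fun r => hG r j k)
  rw [h2, h3, h4, h.dy_delta hp (hg i j)] at h1
  have hC : ∀ a b c, dy c (metric L a b) x y = 2 * cartan L a b c x y := fun a b c => by
    simp only [cartan]; ring
  have h5 : delta L k (dy l (metric L i j)) x y = 2 * delta L k (cartan L i j l) x y := by
    have hDk := isDirAt_delta L h.isOpen hp k
    rw [← hDk.const_mul 2 (h.smooth_cartan i j l)]
    exact hDk.congr ((h.smooth_cartan i j l).const_mul 2)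
      fun x y _ => by simp only [cartan]; ring
  simp only [hC, dy_nonlinear_eq_christoffel hP hp, h5] at h1
  have h6 : ∑ r, christoffel L r k l x y * (2 * cartan L i j r x y)
      = 2 * ∑ r, cartan L i j r x y * christoffel L r l k x y := by
    rw [Finset.mul_sum]
    exact Finset.sum_congr rfl fun r _ => by rw [h.christoffel_symm hp r k l]; ring
  have h7 : ∑ r, 2 * cartan L j r l x y * christoffel L r i k x y
      = 2 * ∑ r, cartan L r j l x y * christoffel L r i k x y := by
    rw [Finset.mul_sum]
    exact Finset.sum_congr rfl fun r _ => by rw [h.cartan_swap hp j r l]; ring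
  have h8 : ∑ r, 2 * cartan L i r l x y * christoffel L r j k x y
      = 2 * ∑ r, cartan L i r l x y * christoffel L r j k x y := by
    rw [Finset.mul_sum]
    exact Finset.sum_congr rfl fun r _ => by ring
  rw [h6, h7, h8] at h1
  linarith

/-- A Landsberg metric has vanishing hv-curvature. -/
theorem hvCurvature_eq_zero (h : LocalFinsler L U)
    (hP : ∀ x y, (x, y) ∈ U → ∀ i j k, hvTorsion L i j k x y = 0) (hp : (x, y) ∈ U)
    (i a j k : Fin n) : hvCurvature L i a j k x y = 0 := by
  suffices H : dy k (christoffel L i a j) x y = hcovCartanUp L i a k j x y by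
    simp only [hvCurvature, H, hP x y hp]
    simp
  refine h.eq_of_lower_eq hp (T := fun i => dy k (christoffel L i a j) x y)
    (S := fun i => hcovCartanUp L i a k j x y) (fun s => ?_) i
  rw [h.lower_hcovCartanUp hp]
  -- ∂̇Γ is now the Berwald curvature, hence symmetric in all three lower indices; `hR1` and `hR2`
  -- record the generating transpositions.
  have hR : ∀ r b c d, dy d (christoffel L r b c) x y = dy d (dy c (nonlinear L r b)) x y :=
    dy_christoffel_eq h.isOpen h.smooth_nonlinear hP hp
  have hR1 : ∀ r b c d, dy d (christoffel L r b c) x y = dy c (christoffel L r b d) x y :=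
    fun r b c d => by rw [hR, hR, dy_dy_comm h.isOpen hp (h.smooth_nonlinear r b)]
  have hR2 : ∀ r b c d, dy d (christoffel L r b c) x y = dy d (christoffel L r c b) x y :=
    fun r b c d => (isDirAt_dy h.isOpen hp d).congr (h.smooth_christoffel r c b)
      fun _ _ hq => h.christoffel_symm hq r b c
  have hsymm : ∀ i j l k, delta L k (cartan L i j l) x y
        - ∑ r, cartan L r j l x y * christoffel L r i k x y
        - ∑ r, cartan L i r l x y * christoffel L r j k x y
        - ∑ r, cartan L i j r x y * christoffel L r l k x y
      = delta L k (cartan L l j i) x y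
        - ∑ r, cartan L r j i x y * christoffel L r l k x y
        - ∑ r, cartan L l r i x y * christoffel L r j k x y
        - ∑ r, cartan L l j r x y * christoffel L r i k x y := by
    intro i j l k
    have h1 : delta L k (cartan L i j l) x y = delta L k (cartan L l j i) x y :=
      (isDirAt_delta L h.isOpen hp k).congr (h.smooth_cartan l j i)
        fun _ _ hq => h.cartan_symm hq i j l
    have h2 : ∀ r, cartan L r j l x y = cartan L l j r x y := fun r => h.cartan_symm hp r j l
    have h3 : ∀ r, cartan L i r l x y = cartan L l r i x y := fun r => h.cartan_symm hp i r l
    have h4 : ∀ r, cartan L i j r x y = cartan L r j i x y := fun r => h.cartan_symm hp i j r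
    simp only [h1, h2, h3, h4]
    ring
  -- Exchanging i and l leaves C_{ijl|k} unchanged. In the formula for it the term lowered by j is
  -- also unchanged, so the other lowered curvature term must be symmetric in i and l.
  have hQ : ∀ i j l k, ∑ r, metric L i r x y * dy l (christoffel L r j k) x y
      = ∑ r, metric L l r x y * dy i (christoffel L r j k) x y := by
    intro i j l k
    have h1 := h.hcov_cartan_eq hP hp i j l k
    have h2 := h.hcov_cartan_eq hP hp l j i k
    rw [hsymm, h2] at h1
    have h3 : ∑ r, metric L j r x y * dy i (christoffel L r l k) x y
        = ∑ r, metric L j r x y * dy l (christoffel L r i k) x y :=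
      Finset.sum_congr rfl fun r _ => by
        rw [hR2 r l k i, hR1 r k l i, hR2 r k i l]
    linarith
  -- By `hQ` the two curvature terms on the right are equal, so the factor 2 cancels.
  have h1 := h.hcov_cartan_eq hP hp s a k j
  have h2 : ∑ r, metric L a r x y * dy k (christoffel L r s j) x y
      = ∑ r, metric L s r x y * dy k (christoffel L r a j) x y := by
    have h3 : ∀ r, dy k (christoffel L r s j) x y = dy s (christoffel L r k j) x y :=
      fun r => by rw [hR2 r s j k, hR1 r j s k, hR2 r j k s]
    have h4 : ∀ r, dy k (christoffel L r a j) x y = dy a (christoffel L r k j) x y :=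
      fun r => by rw [hR2 r a j k, hR1 r j a k, hR2 r j k a]
    simp only [h3, h4]
    exact hQ a k s j
  linarith

end LocalFinsler

end HvCurvature

/-! ### Passage from the manifold to charts. -/

section Charts

variable {n : ℕ} {M : Type*} [TopologicalSpace M] [ChartedSpace (Coord n) M]
  [IsManifold (𝓡 n) ∞ M] {φ : OpenPartialHomeomorph M (Coord n)}

/-- On the chart target this map is the tangent map of the smooth inverse chart, precomposed with
the identification of pairs with tangent vectors of the model space. -/
lemma contMDiffOn_chartVec (hφ : φ ∈ IsManifold.maximalAtlas (𝓡 n) ∞ M) :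
    ContMDiffOn 𝓘(ℝ, Coord n × Coord n) (𝓡 n).tangent ∞
      (fun p : Coord n × Coord n => chartVec φ p.1 p.2) (φ.target ×ˢ Set.univ) := by
  have : IsManifold (𝓡 n) 1 M := IsManifold.of_le (n := ∞) (by simp)
  have h1 : ContMDiffOn (𝓡 n).tangent (𝓡 n).tangent ∞
      (tangentMapWithin (𝓡 n) (𝓡 n) φ.symm φ.target) (Bundle.TotalSpace.proj ⁻¹' φ.target) :=
    (contMDiffOn_symm_of_mem_maximalAtlas hφ).contMDiffOn_tangentMapWithin (by simp)
      φ.open_target.uniqueMDiffOn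
  have h2 : ContMDiff 𝓘(ℝ, Coord n × Coord n) (𝓡 n).tangent ∞
      (fun p : Coord n × Coord n => (⟨p.1, p.2⟩ : TangentBundle (𝓡 n) (Coord n))) := by
    rw [modelWithCornersSelf_prod]
    exact contMDiff_tangentBundleModelSpaceHomeomorph_symm (n := ∞) (I := 𝓡 n)
  have h3 := h1.comp h2.contMDiffOn (s := φ.target ×ˢ Set.univ) (fun p hp => hp.1)
  refine h3.congr fun p hp => ?_
  have h4 : mfderivWithin (𝓡 n) (𝓡 n) φ.symm φ.target p.1 = mfderiv (𝓡 n) (𝓡 n) φ.symm p.1 :=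
    mfderivWithin_of_isOpen φ.open_target hp.1
  simp only [Function.comp, tangentMapWithin, chartVec]
  rw [h4]

/-- The coordinate expression of a subset of the tangent bundle. -/
def chartDomain (φ : OpenPartialHomeomorph M (Coord n)) (S : Set (TangentBundle (𝓡 n) M)) :
    Set (Coord n × Coord n) :=
  φ.target ×ˢ Set.univ ∩ (fun p : Coord n × Coord n => chartVec φ p.1 p.2) ⁻¹' S

lemma isOpen_chartDomain (hφ : φ ∈ IsManifold.maximalAtlas (𝓡 n) ∞ M)
    {S : Set (TangentBundle (𝓡 n) M)} (hS : IsOpen S) : IsOpen (chartDomain φ S) :=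
  (contMDiffOn_chartVec hφ).continuousOn.isOpen_inter_preimage
    (φ.open_target.prod isOpen_univ) hS

omit [IsManifold (𝓡 n) ∞ M] in
lemma chartVec_smul (φ : OpenPartialHomeomorph M (Coord n)) (x y : Coord n) (t : ℝ) :
    chartVec φ x (t • y) = ⟨(chartVec φ x y).1, t • (chartVec φ x y).2⟩ := by
  simp only [chartVec]
  congr 1
  exact map_smul (mfderiv (𝓡 n) (𝓡 n) φ.symm x) t y

/-- The bridge by which every coordinate result applies to the chart expression of a Finsler space.
-/
lemma FinslerSpace.localFinsler (F : FinslerSpace n M)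
    (hφ : φ ∈ IsManifold.maximalAtlas (𝓡 n) ∞ M) :
    LocalFinsler (inChart F.L φ) (chartDomain φ F.dom) where
  isOpen := isOpen_chartDomain hφ F.isOpen_dom
  conic x y hp t ht := by
    refine ⟨⟨hp.1.1, trivial⟩, ?_⟩
    have := F.smul_mem _ hp.2 t ht
    rw [← chartVec_smul] at this
    exact this
  smooth := by
    have := F.smooth.comp ((contMDiffOn_chartVec hφ).mono Set.inter_subset_left)
      (fun p (hp : p ∈ chartDomain φ F.dom) => hp.2)
    exact contMDiffOn_iff_contDiffOn.1 this
  pos x y hp := F.pos _ hp.2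
  homogeneous x y hp t ht := by
    have := F.homogeneous _ hp.2 t ht
    rw [← chartVec_smul] at this
    rw [pow_one]
    exact this
  nondegenerate x y hp := F.nondegenerate φ hφ x hp.1.1 y hp.2

lemma OneForm.inChart_beta (b : OneForm n M) (x y : Coord n) :
    inChart b.beta φ x y = ∑ i, inChart b.beta φ x (basisVec i) * y i := by
  have h1 : ∀ y, inChart b.beta φ x y
      = b.form (φ.symm x) (mfderiv (𝓡 n) (𝓡 n) φ.symm x y) := fun _ => rfl
  let T : Coord n →ₗ[ℝ] ℝ :=
    (b.form (φ.symm x)).comp (mfderiv (𝓡 n) (𝓡 n) φ.symm x).toLinearMap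
  change T y = ∑ i, T (basisVec i) * y i
  conv_lhs => rw [coord_eq_sum y]
  simp only [map_sum, map_smul, smul_eq_mul, mul_comm]

lemma OneForm.smoothOn_component (b : OneForm n M)
    (hφ : φ ∈ IsManifold.maximalAtlas (𝓡 n) ∞ M) (i : Fin n) :
    SmoothOn (φ.target ×ˢ Set.univ) (b.component φ i) := by
  have h1 : ContDiffOn ℝ ∞ (fun p : Coord n × Coord n => inChart b.beta φ p.1 p.2)
      (φ.target ×ˢ Set.univ) :=
    contMDiffOn_iff_contDiffOn.1 (b.smooth.comp_contMDiffOn (contMDiffOn_chartVec hφ))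
  have h2 : ContDiff ℝ ∞ (fun p : Coord n × Coord n => (p.1, (basisVec i : Coord n))) := by
    fun_prop
  exact h1.comp h2.contDiffOn fun p hp => ⟨hp.1, trivial⟩

omit [IsManifold (𝓡 n) ∞ M] in
lemma hasFDerivAt_homothetic {σ : M → ℝ} (hs : ContMDiff (𝓡 n) 𝓘(ℝ, ℝ) ∞ σ)
    (hσ : Homothetic n σ) (hφ : φ ∈ IsManifold.maximalAtlas (𝓡 n) ∞ M) {x : Coord n}
    (hx : x ∈ φ.target) : HasFDerivAt (fun x => σ (φ.symm x)) (0 : Coord n →L[ℝ] ℝ) x := by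
  have h1 : MDifferentiableAt (𝓡 n) (𝓡 n) φ.symm x :=
    ((contMDiffOn_symm_of_mem_maximalAtlas hφ).contMDiffAt
      (φ.open_target.mem_nhds hx)).mdifferentiableAt (by simp)
  have h2 : MDifferentiableAt (𝓡 n) 𝓘(ℝ, ℝ) σ (φ.symm x) := hs.mdifferentiableAt (by simp)
  have h3 := h2.hasMFDerivAt.comp x h1.hasMFDerivAt
  rw [hσ (φ.symm x)] at h3
  exact h3.hasFDerivAt.congr_fderiv (ContinuousLinearMap.ext fun _ => rfl)

/-! ### The generalized β-conformal change. -/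

variable {F F' : FinslerSpace n M} {f : ℝ → ℝ → ℝ} {D : Set (ℝ × ℝ)} {σ : M → ℝ}
  {b : OneForm n M}

/-- Under a homothetic `β`-conformal change, `L'` is stationary wherever `L` and `β` are. -/
lemma IsGeneralizedBetaConformalChange.dir_eq_zero
    (hchange : IsGeneralizedBetaConformalChange F F' f D σ b) (hσ : Homothetic n σ)
    (hφ : φ ∈ IsManifold.maximalAtlas (𝓡 n) ∞ M) {x y : Coord n}
    (hp : (x, y) ∈ chartDomain φ F'.dom) (v : Coord n × Coord n)
    (hL : dir v (inChart F.L φ) x y = 0) (hbeta : dir v (inChart b.beta φ) x y = 0) :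
    dir v (inChart F'.L φ) x y = 0 := by
  have hU := isOpen_chartDomain hφ F'.isOpen_dom
  have h1 := (((F.localFinsler hφ).smooth.mono (fun p hq =>
    ⟨hq.1, hchange.dom_subset hq.2⟩)).differentiableAt hU hp).hasFDerivAt
  have hb : SmoothOn (chartDomain φ F'.dom) (inChart b.beta φ) := by
    refine SmoothOn.congr (SmoothOn.sum (s := Finset.univ) fun i =>
      ((b.smoothOn_component hφ i).mono Set.inter_subset_left).mul (smoothOn_coord i))
      fun x y _ => b.inChart_beta x y
  have h2 := (hb.differentiableAt hU hp).hasFDerivAt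
  -- As dσ = 0, the factor e^σ behaves as a constant to first order, so the differential of e^σ L is
  -- e^σ dL.
  have h3 : HasFDerivAt (fun p : Coord n × Coord n => Real.exp (σ (φ.symm p.1)))
      (0 : Coord n × Coord n →L[ℝ] ℝ) (x, y) := by
    have := ((hasFDerivAt_homothetic hchange.smooth_sigma hσ hφ hp.1.1).comp (x, y)
      hasFDerivAt_fst).exp
    simp only [ContinuousLinearMap.zero_comp, smul_zero] at this
    exact this
  have h4 := (h3.mul h1).prodMk h2
  have h5 : HasFDerivAt (fun q : ℝ × ℝ => f q.1 q.2) _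
      (Real.exp (σ (φ.symm x)) * inChart F.L φ x y, inChart b.beta φ x y) :=
    ((hchange.smooth_f.contDiffAt (hchange.isOpen.mem_nhds
      (hchange.mem _ hp.2))).differentiableAt (by simp)).hasFDerivAt
  have h6 := HasFDerivAt.comp (x, y) h5 h4
  have h7 : (fun p : Coord n × Coord n => inChart F'.L φ p.1 p.2) =ᶠ[nhds (x, y)]
      (fun q : ℝ × ℝ => f q.1 q.2) ∘ fun p : Coord n × Coord n =>
        (Real.exp (σ (φ.symm p.1)) * inChart F.L φ p.1 p.2, inChart b.beta φ p.1 p.2) := by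
    -- The defining relation holds only on the domain of F', whose openness makes it an equality of
    -- germs that can be differentiated.
    filter_upwards [hU.mem_nhds hp] with p hq using hchange.eq _ hq.2
  have h8 := (h6.congr_of_eventuallyEq h7).fderiv
  simp only [dir] at hL hbeta ⊢
  rw [h8]
  simp only [ContinuousLinearMap.comp_apply, ContinuousLinearMap.prod_apply, smul_apply,
    smul_zero, add_zero, hL, hbeta]
  exact map_zero _

theorem IsGeneralizedBetaConformalChange.hvTorsionVanishes
    (hchange : IsGeneralizedBetaConformalChange F F' f D σ b)
    (hb : F.CartanParallel b) (hσ : Homothetic n σ) (hP : F.HvTorsionVanishes) :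
    F'.HvTorsionVanishes := by
  intro φ hφ x hx y hy i j k
  have h' := F'.localFinsler hφ
  -- Both metrics are taken on the smaller domain, that of F'. It is open, so the hypotheses on F
  -- can still be differentiated there.
  have h : LocalFinsler (inChart F.L φ) (chartDomain φ F'.dom) :=
    (F.localFinsler hφ).mono h'.isOpen h'.conic fun p hq => ⟨hq.1, hchange.dom_subset hq.2⟩
  refine h.hvTorsion_eq_zero_of_change h'
    (c := fun i x => inChart b.beta φ x (basisVec i))
    (fun i => (b.smoothOn_component hφ i).mono Set.inter_subset_left)
    (fun x y hq => hb φ hφ x hq.1.1 y (hchange.dom_subset hq.2))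
    (fun x y hq v h1 h2 => hchange.dir_eq_zero hσ hφ hq v h1 ?_)
    (fun x y hq => hP φ hφ x hq.1.1 y (hchange.dom_subset hq.2)) ⟨⟨hx, trivial⟩, hy⟩ i j k
  rw [dir_congr h.isOpen hq v fun x y _ => b.inChart_beta x y]
  exact h2

/-- The hv-curvature of the Cartan connection vanishes iff its (v)hv-torsion does. -/
theorem FinslerSpace.hvCurvatureVanishes_iff (F : FinslerSpace n M) :
    F.HvCurvatureVanishes ↔ F.HvTorsionVanishes := by
  constructor
  · intro H φ hφ x hx y hy i j k
    rw [← (F.localFinsler hφ).sum_coord_hvCurvature ⟨⟨hx, trivial⟩, hy⟩]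
    simp [H φ hφ x hx y hy]
  · intro H φ hφ x hx y hy i a j k
    exact (F.localFinsler hφ).hvCurvature_eq_zero
      (fun x y hq => H φ hφ x hq.1.1 y hq.2) ⟨⟨hx, trivial⟩, hy⟩ i a j k

end Charts

end Finsler

theorem mainTheorem11 {n : ℕ} {M : Type*} [TopologicalSpace M]
    [ChartedSpace (EuclideanSpace ℝ (Fin n)) M] [IsManifold (𝓡 n) ∞ M]
    (F F' : Finsler.FinslerSpace n M) (f : ℝ → ℝ → ℝ) (D : Set (ℝ × ℝ)) (σ : M → ℝ)
    (b : Finsler.OneForm n M)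
    (hchange : Finsler.IsGeneralizedBetaConformalChange F F' f D σ b)
    (hb : F.CartanParallel b) (hσ : Finsler.Homothetic n σ) :
    (F.HvTorsionVanishes → F'.HvTorsionVanishes) ∧
      (F.HvCurvatureVanishes → F'.HvCurvatureVanishes) := by
  -- The curvature statement is reduced to the torsion one by applying the equivalence of the two
  -- Landsberg conditions to F and to F'.
  have h := hchange.hvTorsionVanishes hb hσ
  exact ⟨h, fun H => F'.hvCurvatureVanishes_iff.2 (h (F.hvCurvatureVanishes_iff.1 H))⟩
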